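/- Let $D=[0,1]^2$ with coordinates $(t,x)$ (time, space), let $\mathcal M(D)$ be the set of positive finite Radon measures on $D$ with the weak topology (convergence against continuous functions), and let $L^2=L^2([0,1])$ in the space variable. For $q\in L^2$ put $$\eta(q)(x)=\exp\Big(\int_0^x q\,du\Big),\qquad \varphi(q)(x)=\int_0^x\eta(q)\,dy,$$ $$Q=\Big\{q\in L^2:\ \int_0^1 q\,dx=0,\ \int_0^1\eta(q)\,dx=1\Big\},\qquad T_q^*Q=\Big\{p\in L^2:\ \int_0^1\eta(q)\,p\,dx=0,\ \int_0^1\eta(q)\,\varphi(q)\,p\,dx=0\Big\}.$$ Given $p_0,q_0\in L^2$, let $\mathcal C^0$ be the set of pairs $(p,q)\in H^1([0,1],L^2)\times H^2([0,1],L^2)$ with $q(t)\in Q$ and $p(t)\in T^*_{q(t)}Q$ for all $t\in[0,1]$, $\dot q=\eta(q)p$, and $q(0)=q_0$, $p(0)=p_0$. Given also $p_1,q_1\in L^2$, let $\mathcal C^{0,1}$ be the subset of those pairs with moreover $q(1)=q_1$, $p(1)=p_1$. (These sets are empty unless $q_i\in Q$ and $p_i\in T^*_{q_i}Q$.) Let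 $r(x,y)=\frac{y^2}{4x}$ if $x>0$, $r(0,0)=0$, and $r=+\infty$ otherwise. For $\mu\in\mathcal M(D)$, a finite signed measure $\sigma$ on $D$ and $f\in C^0(D)$ with $f>0$, let $$\mathrm{FR}_f(\mu,\sigma)=\int_D r\Big(\frac{d\mu}{d\lambda},\frac{d\sigma}{d\lambda}\Big) f\,d\lambda ,$$ for any finite positive measure $\lambda$ dominating $\mu$ and $|\sigma|$. We write $\mathrm{FR}(\mu,\partial_t\mu)\preccurlyeq\nu$ if the distributional time derivative $\partial_t\mu$ (tested against smooth functions on $D$ that vanish for $t$ near $0$ and $1$) is a finite signed measure $\sigma$ and $\mathrm{FR}_f(\mu,\sigma)\le\int_D f\,d\nu$ for all $f\in C^0(D)$ with $f>0$. The set $\mathcal C_R^0$ of relaxed curves consists of the $(p,q,\mu,\nu)$ with $(p,q)\in\mathcal C^0$ and $\mu,\nu\in\mathcal M(D)$ such that $$\mu\ge p^2\,dt\,dx,\qquad \nu\ge\dot p^2\,dt\,dx,\qquad \mathrm{FR}(\mu-p^2,\partial_t(\mu-p^2))\preccurlyeq\nu-\dot p^2,$$ and $\mu(0)=p(0)^2\,dx$,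 where $\mu=\mu(t)\,dt$ for a weakly continuous path $t\in[0,1]\mapsto\mu(t)$ of positive finite measures on $[0,1]$. The set $\mathcal C_R^{0,1}$ is defined in the same way, with $\mathcal C^{0,1}$ in place of $\mathcal C^0$ and the additional constraint $\mu(1)=p(1)^2\,dx$. **Proposition.** The sets $\mathcal C_R^0$ and $\mathcal C_R^{0,1}$ are closed in $H^1([0,1],L^2)\times H^2([0,1],L^2)\times\mathcal M(D)^2$ endowed with the product of the weak topologies. In particular they are closed in $\mathcal C^0\times\mathcal M(D)^2$, respectively $\mathcal C^{0,1}\times\mathcal M(D)^2$, for the weak topology. -/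

import Mathlib

open MeasureTheory Set Topology
open scoped ContDiff ENNReal unitInterval

noncomputable section

namespace RelaxedCubics

/-- The time-space square `[0,1]²`; the first coordinate is time `t`, the second is space `x`.
It carries the Lebesgue measure `dt dx`. -/
abbrev Square : Type := I × I

/-- The space `L²([0,1])` of functions of the space variable. -/
abbrev L2Space : Type := Lp ℝ 2 (volume : Measure I)

/-- The space `L²([0,1]²)`, identified as usual with `L²([0,1], L²([0,1]))`. -/
abbrev L2Square : Type := Lp ℝ 2 (volume : Measure Square)

/-! ### Test functions and the Sobolev spaces `H¹([0,1], L²)` and `H²([0,1], L²)` -/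

/-- Smooth compactly supported functions on `(0,1) × ℝ`, to be restricted to the square: they
vanish near the times `0` and `1`, with no restriction at the boundary in space. -/
def IsTimeTest (f : ℝ × ℝ → ℝ) : Prop :=
  ContDiff ℝ ∞ f ∧ HasCompactSupport f ∧ tsupport f ⊆ Ioo (0 : ℝ) 1 ×ˢ univ

/-- A point of the square as a point of the plane. -/
def toPlane (z : Square) : ℝ × ℝ := ((z.1 : ℝ), (z.2 : ℝ))

/-- The time derivative `∂ₜ f` of a function on the plane, at a point of the square. -/
def timeDeriv (f : ℝ × ℝ → ℝ) (z : Square) : ℝ := fderiv ℝ f (toPlane z) (1, 0)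

/-- `v` is the weak time derivative of `u`. -/
def IsWeakTimeDeriv (u v : L2Square) : Prop :=
  ∀ f : ℝ × ℝ → ℝ, IsTimeTest f →
    ∫ z : Square, u z * timeDeriv f z = - ∫ z : Square, v z * f (toPlane z)

theorem continuous_toPlane : Continuous toPlane := by
  unfold toPlane
  fun_prop

theorem IsTimeTest.continuous_comp {f : ℝ × ℝ → ℝ} (hf : IsTimeTest f) :
    Continuous fun z : Square => f (toPlane z) :=
  hf.1.continuous.comp continuous_toPlane

theorem IsTimeTest.continuous_timeDeriv {f : ℝ × ℝ → ℝ} (hf : IsTimeTest f) :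
    Continuous (timeDeriv f) := by
  have h : Continuous (fderiv ℝ f) := hf.1.continuous_fderiv (by simp)
  exact (h.comp continuous_toPlane).clm_apply continuous_const

theorem integrable_mul_continuous (u : L2Square) {g : Square → ℝ} (hg : Continuous g) :
    Integrable (fun z : Square => u z * g z) := by
  obtain ⟨C, hC⟩ := isCompact_univ.exists_bound_of_continuousOn hg.continuousOn
  exact ((Lp.memLp u).integrable one_le_two).mul_bdd hg.aestronglyMeasurable
    (Filter.Eventually.of_forall fun z => hC z (mem_univ z))

theorem integral_add_mul (u v : L2Square) {g : Square → ℝ} (hg : Continuous g) :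
    ∫ z : Square, (u + v : L2Square) z * g z
      = (∫ z : Square, u z * g z) + ∫ z : Square, v z * g z := by
  rw [← integral_add (integrable_mul_continuous u hg) (integrable_mul_continuous v hg)]
  refine integral_congr_ae ?_
  filter_upwards [Lp.coeFn_add u v] with z hz
  rw [hz, Pi.add_apply, add_mul]

theorem integral_smul_mul (c : ℝ) (u : L2Square) (g : Square → ℝ) :
    ∫ z : Square, (c • u : L2Square) z * g z = c * ∫ z : Square, u z * g z := by
  rw [← integral_const_mul]
  refine integral_congr_ae ?_
  filter_upwards [Lp.coeFn_smul c u] with z hz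
  rw [hz, Pi.smul_apply, smul_eq_mul, mul_assoc]

theorem integral_zero_mul (g : Square → ℝ) :
    ∫ z : Square, (0 : L2Square) z * g z = 0 := by
  simpa only [zero_smul, zero_mul] using integral_smul_mul 0 0 g

theorem IsWeakTimeDeriv.zero : IsWeakTimeDeriv 0 0 := by
  intro f _
  rw [integral_zero_mul, integral_zero_mul (fun z => f (toPlane z)), neg_zero]

theorem IsWeakTimeDeriv.add {u v u' v' : L2Square} (h : IsWeakTimeDeriv u v)
    (h' : IsWeakTimeDeriv u' v') : IsWeakTimeDeriv (u + u') (v + v') := by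
  intro f hf
  rw [integral_add_mul u u' hf.continuous_timeDeriv, integral_add_mul v v' hf.continuous_comp,
    h f hf, h' f hf, neg_add]

theorem IsWeakTimeDeriv.smul {u v : L2Square} (c : ℝ) (h : IsWeakTimeDeriv u v) :
    IsWeakTimeDeriv (c • u) (c • v) := by
  intro f hf
  rw [integral_smul_mul, integral_smul_mul c v (fun z => f (toPlane z)), h f hf, mul_neg]

/-- The Sobolev space `H¹([0,1], L²([0,1]))`: the pairs `(u, u̇)` of square integrable functions
such that `u̇` is the weak time derivative of `u`. Its norm is
`max (‖u‖, ‖u̇‖)`, which is equivalent to the Hilbert norm and so has the same weak topology. -/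
def H1 : Submodule ℝ (L2Square × L2Square) where
  carrier := {w | IsWeakTimeDeriv w.1 w.2}
  zero_mem' := IsWeakTimeDeriv.zero
  add_mem' h h' := h.add h'
  smul_mem' c _ h := h.smul c

/-- The Sobolev space `H²([0,1], L²([0,1]))`: the triples `(u, u̇, ü)` of square integrable
functions such that `u̇`, `ü` are the first two weak time derivatives of `u`. -/
def H2 : Submodule ℝ (L2Square × L2Square × L2Square) where
  carrier := {w | IsWeakTimeDeriv w.1 w.2.1 ∧ IsWeakTimeDeriv w.2.1 w.2.2}
  zero_mem' := ⟨IsWeakTimeDeriv.zero, IsWeakTimeDeriv.zero⟩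
  add_mem' h h' := ⟨h.1.add h'.1, h.2.add h'.2⟩
  smul_mem' c _ h := ⟨h.1.smul c, h.2.smul c⟩

/-- The element `u` of an `H¹` space. -/
def H1.fn (p : H1) : L2Square := p.1.1

/-- Its time derivative `u̇`. -/
def H1.dot (p : H1) : L2Square := p.1.2

/-- The element `u` of an `H²` space. -/
def H2.fn (q : H2) : L2Square := q.1.1

/-- Its time derivative `u̇`. -/
def H2.dot (q : H2) : L2Square := q.1.2.1

/-- `c` is the representative of `u` in `C⁰([0,1], L²([0,1]))`. It is unique, and it exists for
every element of `H¹([0,1], L²([0,1]))`; the values of `u` at given times are those of `c`. -/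
def IsContinuousRep (u : L2Square) (c : I → L2Space) : Prop :=
  Continuous c ∧ ∀ᵐ t : I, (c t : I → ℝ) =ᵐ[volume] fun x => u (t, x)

/-! ### The manifold of diffeomorphisms in the coordinate `q = ∂ₓ log ∂ₓ φ` -/

/-- `η(q)(x) = exp (∫₀ˣ q)`. -/
def eta (q : I → ℝ) (x : I) : ℝ := Real.exp (∫ u in Iic x, q u)

/-- `φ(q)(x) = ∫₀ˣ η(q)`. -/
def phi (q : I → ℝ) (x : I) : ℝ := ∫ y in Iic x, eta q y

/-- The submanifold `Q` of `L²([0,1])`. -/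
def Q : Set L2Space := {q | ∫ x, q x = 0 ∧ ∫ x, eta q x = 1}

/-- The cotangent space `T_q^*Q`, i.e. the range of the projection `π_q^*`: the elements of
`L²([0,1])` orthogonal to `1` and to `φ(q)` for the scalar product with weight `η(q)`
(equivalently, `η(q) p` is tangent to `Q` at `q`). -/
def cotangent (q : L2Space) : Set L2Space :=
  {p | ∫ x, eta q x * p x = 0 ∧ ∫ x, eta q x * (phi q x * p x) = 0}

/-! ### Curves -/

/-- `(p, q)` is a curve in `T^*Q` with `q̇ = η(q) p`, and `P`, `R` are the time-continuous
representatives of `p`, `q`. -/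
structure IsCurve (p : H1) (q : H2) (P R : I → L2Space) : Prop where
  rep_p : IsContinuousRep (H1.fn p) P
  rep_q : IsContinuousRep (H2.fn q) R
  mem_Q : ∀ t, R t ∈ Q
  mem_cotangent : ∀ t, P t ∈ cotangent (R t)
  ode : ∀ᵐ z : Square, H2.dot q z = eta (fun u => H2.fn q (z.1, u)) z.2 * H1.fn p z

/-- The set `𝒞⁰`: curves with initial conditions `p(0) = p₀`, `q(0) = q₀`. -/
def curves0 (p₀ q₀ : L2Space) : Set (H1 × H2) :=
  {c | ∃ P R : I → L2Space, IsCurve c.1 c.2 P R ∧ P 0 = p₀ ∧ R 0 = q₀}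

/-- The set `𝒞^{0,1}`: curves with prescribed values of `(p, q)` at times `0` and `1`. -/
def curves01 (p₀ q₀ p₁ q₁ : L2Space) : Set (H1 × H2) :=
  {c | ∃ P R : I → L2Space,
    IsCurve c.1 c.2 P R ∧ P 0 = p₀ ∧ R 0 = q₀ ∧ P 1 = p₁ ∧ R 1 = q₁}

/-! ### The Fisher-Rao functional -/

/-- The one-homogeneous convex function `r(x,y) = y² / (4x)` for `x > 0`, `r(0,0) = 0`, and
`r = +∞` elsewhere. -/
def rFun (x y : ℝ) : ℝ≥0∞ :=
  if 0 < x then ENNReal.ofReal (y ^ 2 / (4 * x)) else if x = 0 ∧ y = 0 then 0 else ⊤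

/-- The Fisher-Rao functional `FR_f(μ,τ) = ∫ r(dμ/dλ, dτ/dλ) f dλ`, with the dominating measure
`λ = μ + |τ|` (by homogeneity of `r` its choice does not matter). -/
def fisherRao (f : C(Square, ℝ)) (μ : Measure Square) (τ : SignedMeasure Square) : ℝ≥0∞ :=
  ∫⁻ z, rFun (μ.rnDeriv (μ + τ.totalVariation) z).toReal (τ.rnDeriv (μ + τ.totalVariation) z)
    * ENNReal.ofReal (f z) ∂(μ + τ.totalVariation)

/-- The integral of a function against a signed measure. -/
def signedIntegral (τ : SignedMeasure Square) (f : Square → ℝ) : ℝ :=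
  (∫ z, f z ∂τ.toJordanDecomposition.posPart) - ∫ z, f z ∂τ.toJordanDecomposition.negPart

/-- The distributional time derivative of `μ` is the signed measure `τ`. -/
def IsTimeDerivMeasure (μ : Measure Square) (τ : SignedMeasure Square) : Prop :=
  ∀ f : ℝ × ℝ → ℝ, IsTimeTest f →
    ∫ z, timeDeriv f z ∂μ = - signedIntegral τ fun z => f (toPlane z)

/-- `FR(μ, ∂ₜμ) ≼ ν`: the distribution `∂ₜμ` is a measure, and `FR_f(μ, ∂ₜμ) ≤ ⟨ν, f⟩` for all
continuous positive functions `f` on the square. -/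
def FisherRaoLE (μ ν : Measure Square) : Prop :=
  ∃ τ : SignedMeasure Square, IsTimeDerivMeasure μ τ ∧
    ∀ f : C(Square, ℝ), (∀ z, 0 < f z) → fisherRao f μ τ ≤ ∫⁻ z, ENNReal.ofReal (f z) ∂ν

/-! ### Relaxed curves -/

/-- The measure `u²`, with density `u²` with respect to the Lebesgue measure. -/
def sqMeasure {α : Type*} [MeasureSpace α] (u : α → ℝ) : Measure α :=
  (volume : Measure α).withDensity fun z => ENNReal.ofReal (u z ^ 2)

/-- `μ = μ(t) dt` for the weakly continuous path of measures `m : t ↦ μ(t)` on `[0,1]`.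
Such a path is unique. -/
def IsDisintegration (μ : Measure Square) (m : I → FiniteMeasure I) : Prop :=
  Continuous m ∧ ∀ f : C(Square, ℝ),
    ∫ z, f z ∂μ = ∫ t : I, ∫ x : I, f (t, x) ∂(m t : Measure I)

/-- The space in which relaxed curves live: `H¹ × H²`, with its weak topology, times two
copies of the positive finite Radon measures on the square, with the weak topology. -/
abbrev RelaxedSpace : Type :=
  WeakSpace ℝ H1 × WeakSpace ℝ H2 × FiniteMeasure Square × FiniteMeasure Square

/-- The component `p` of `(p, q, μ, ν)`. -/
def RelaxedSpace.p (w : RelaxedSpace) : H1 := (toWeakSpace ℝ H1).symm w.1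

/-- The component `q` of `(p, q, μ, ν)`. -/
def RelaxedSpace.q (w : RelaxedSpace) : H2 := (toWeakSpace ℝ H2).symm w.2.1

/-- The component `μ` of `(p, q, μ, ν)`. -/
def RelaxedSpace.μ (w : RelaxedSpace) : Measure Square := w.2.2.1

/-- The component `ν` of `(p, q, μ, ν)`. -/
def RelaxedSpace.ν (w : RelaxedSpace) : Measure Square := w.2.2.2

/-- The conditions `μ ≥ p²`, `ν ≥ ṗ²` and `FR(μ - p², ∂ₜ(μ - p²)) ≼ ν - ṗ²`. -/
structure IsRelaxation (p : H1) (μ ν : Measure Square) : Prop where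
  sq_le : sqMeasure (H1.fn p) ≤ μ
  sq_dot_le : sqMeasure (H1.dot p) ≤ ν
  fisherRao_le : FisherRaoLE (μ - sqMeasure (H1.fn p)) (ν - sqMeasure (H1.dot p))

/-- The set `𝒞_R⁰` of relaxed curves: `(p, q) ∈ 𝒞⁰` and `μ(0) = p(0)²`. -/
def relaxedCurves0 (p₀ q₀ : L2Space) : Set RelaxedSpace :=
  {w | (w.p, w.q) ∈ curves0 p₀ q₀ ∧ IsRelaxation w.p w.μ w.ν ∧
    ∃ m : I → FiniteMeasure I, IsDisintegration w.μ m ∧ (m 0 : Measure I) = sqMeasure p₀}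

/-- The set `𝒞_R^{0,1}` of relaxed curves with constraints at time `1`: `(p, q) ∈ 𝒞^{0,1}`,
`μ(0) = p(0)²` and `μ(1) = p(1)²`. -/
def relaxedCurves01 (p₀ q₀ p₁ q₁ : L2Space) : Set RelaxedSpace :=
  {w | (w.p, w.q) ∈ curves01 p₀ q₀ p₁ q₁ ∧ IsRelaxation w.p w.μ w.ν ∧
    ∃ m : I → FiniteMeasure I, IsDisintegration w.μ m ∧
      (m 0 : Measure I) = sqMeasure p₀ ∧ (m 1 : Measure I) = sqMeasure p₁}

end RelaxedCubics

end

/-!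
Weakly convergent nets in `H¹ × H²` need not be bounded. Along a net of relaxed curves, however, the
masses of `μ` and `ν` converge, and since `p² ≤ μ` and `ṗ² ≤ ν` they eventually bound `p` and `ṗ`
in `L²`.

The primitive in space is a compact operator on `L²`, so `η` turns weak convergence of `q(t)` into
uniform convergence as long as `q(t)` stays bounded; the equation `q̇ = η(q) p` propagates such a
bound from one time interval to the next. Hence the constraints `q(t) ∈ Q`, `p(t) ∈ T*Q` and the
equation itself pass to the limit.

The Fisher-Rao domination `FR(μ, ∂ₜμ) ≼ ν` is equivalent to `⟨∂ₜμ, g h⟩ ≤ ∫ g² dμ + ∫ h² dν` for all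
continuous `g`, `h`. This is linear in `(μ, ∂ₜμ, ν)`, hence stable under weak limits. The measure
`p²` is not weakly continuous in `p`, but for `pᵢ → p` weakly the lost mass is the limit of
`(pᵢ - p)²`, and `FR(v², ∂ₜ(v²)) ≼ v̇²` for `v = pᵢ - p`; so it can be added to the defect `μ - p²`.

Finally, domination makes the disintegration `μ(t)` Hölder continuous of exponent `1/2` with a
constant that depends only on the masses of `μ` and `ν`. By Arzelà-Ascoli the disintegrations
converge at every time, which gives the conditions at times `0` and `1`.
-/

noncomputable section

namespace RelaxedCubics

open Filter

/-! ### Square-integrable functions -/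

section SquareIntegrable

variable {α : Type*} {m : MeasurableSpace α} {μ : Measure α}

theorem real_inner_eq_integral_mul (f g : Lp ℝ 2 μ) : inner ℝ f g = ∫ x, f x * g x ∂μ := by
  rw [L2.inner_def]
  exact integral_congr_ae (Eventually.of_forall fun x => mul_comm _ _)

theorem norm_sq_eq_integral_sq (f : Lp ℝ 2 μ) : ‖f‖ ^ 2 = ∫ x, f x ^ 2 ∂μ := by
  rw [← real_inner_self_eq_norm_sq, real_inner_eq_integral_mul]
  simp only [sq]

theorem integrable_coeFn [IsFiniteMeasure μ] (f : Lp ℝ 2 μ) : Integrable f μ :=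
  (Lp.memLp f).integrable one_le_two

theorem integrable_coeFn_mul (f g : Lp ℝ 2 μ) : Integrable (fun x => f x * g x) μ :=
  (Lp.memLp f).integrable_mul (Lp.memLp g)

theorem integrable_coeFn_sq (f : Lp ℝ 2 μ) : Integrable (fun x => f x ^ 2) μ :=
  (Lp.memLp f).integrable_sq

end SquareIntegrable

section Product

variable {α β : Type*} [MeasureSpace α] [MeasureSpace β]

theorem ae_fst {p : α → Prop} (h : ∀ᵐ s, p s) : ∀ᵐ z : α × β, p z.1 :=
  Measure.quasiMeasurePreserving_fst.ae h

theorem ae_snd {p : β → Prop} (h : ∀ᵐ x, p x) : ∀ᵐ z : α × β, p z.2 :=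
  Measure.quasiMeasurePreserving_snd.ae h

theorem ae_ae_of_ae_prod_symm [SFinite (volume : Measure α)] [SFinite (volume : Measure β)]
    {p : α × β → Prop} (h : ∀ᵐ z, p z) : ∀ᵐ x : β, ∀ᵐ s : α, p (s, x) :=
  Measure.ae_ae_of_ae_prod
    (Measure.measurePreserving_swap (μ := (volume : Measure β)) (ν := (volume : Measure α))
      |>.quasiMeasurePreserving.ae h)

theorem integrable_mul_fst [IsFiniteMeasure (volume : Measure β)]
    (u : Lp ℝ 2 (volume : Measure (α × β))) (k : Lp ℝ 2 (volume : Measure α)) :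
    Integrable fun z : α × β => u z * k z.1 :=
  (Lp.memLp u).integrable_mul ((Lp.memLp k).comp_fst volume)

theorem integrable_mul_snd [IsFiniteMeasure (volume : Measure α)]
    [SFinite (volume : Measure β)]
    (u : Lp ℝ 2 (volume : Measure (α × β))) (h : Lp ℝ 2 (volume : Measure β)) :
    Integrable fun z : α × β => u z * h z.2 :=
  (Lp.memLp u).integrable_mul ((Lp.memLp h).comp_snd volume)

theorem memLp_mul_prod (k : Lp ℝ 2 (volume : Measure α)) (h : Lp ℝ 2 (volume : Measure β)) :
    MemLp (fun z : α × β => k z.1 * h z.2) 2 volume := by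
  have hm : AEStronglyMeasurable fun z : α × β => k z.1 * h z.2 :=
    ((Lp.aestronglyMeasurable k).comp_quasiMeasurePreserving
        Measure.quasiMeasurePreserving_fst).mul
      ((Lp.aestronglyMeasurable h).comp_quasiMeasurePreserving
        Measure.quasiMeasurePreserving_snd)
  rw [memLp_two_iff_integrable_sq hm]
  simp only [mul_pow]
  exact (integrable_coeFn_sq k).mul_prod (integrable_coeFn_sq h)

/-- The tensor product `k ⊗ h` of two square-integrable functions, `(s, x) ↦ k(s) h(x)`. -/
def tensor (k : Lp ℝ 2 (volume : Measure α)) (h : Lp ℝ 2 (volume : Measure β)) :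
    Lp ℝ 2 (volume : Measure (α × β)) :=
  (memLp_mul_prod k h).toLp _

theorem coeFn_tensor (k : Lp ℝ 2 (volume : Measure α)) (h : Lp ℝ 2 (volume : Measure β)) :
    tensor k h =ᵐ[volume] fun z => k z.1 * h z.2 :=
  (memLp_mul_prod k h).coeFn_toLp

theorem tensor_add_left (k k' : Lp ℝ 2 (volume : Measure α)) (h : Lp ℝ 2 (volume : Measure β)) :
    tensor (k + k') h = tensor k h + tensor k' h := by
  apply Lp.ext
  filter_upwards [coeFn_tensor (k + k') h, coeFn_tensor k h, coeFn_tensor k' h,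
    ae_fst (Lp.coeFn_add k k'), Lp.coeFn_add (tensor k h) (tensor k' h)] with z h₁ h₂ h₃ h₄ h₅
  rw [h₁, h₅, Pi.add_apply, h₂, h₃, h₄, Pi.add_apply, add_mul]

theorem tensor_smul_left (c : ℝ) (k : Lp ℝ 2 (volume : Measure α))
    (h : Lp ℝ 2 (volume : Measure β)) : tensor (c • k) h = c • tensor k h := by
  apply Lp.ext
  filter_upwards [coeFn_tensor (c • k) h, coeFn_tensor k h, ae_fst (Lp.coeFn_smul c k),
    Lp.coeFn_smul c (tensor k h)] with z h₁ h₂ h₃ h₄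
  rw [h₁, h₄, Pi.smul_apply, h₂, h₃, Pi.smul_apply, smul_mul_assoc]

theorem integrable_mul_tensor (k : Lp ℝ 2 (volume : Measure α))
    (u : Lp ℝ 2 (volume : Measure (α × β))) (h : Lp ℝ 2 (volume : Measure β)) :
    Integrable fun z : α × β => u z * (k z.1 * h z.2) :=
  (integrable_coeFn_mul u (tensor k h)).congr <| by
    filter_upwards [coeFn_tensor k h] with z hz
    rw [hz]

theorem tensor_add_right (k : Lp ℝ 2 (volume : Measure α)) (h h' : Lp ℝ 2 (volume : Measure β)) :
    tensor k (h + h') = tensor k h + tensor k h' := by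
  apply Lp.ext
  filter_upwards [coeFn_tensor k (h + h'), coeFn_tensor k h, coeFn_tensor k h',
    ae_snd (Lp.coeFn_add h h'), Lp.coeFn_add (tensor k h) (tensor k h')] with z h₁ h₂ h₃ h₄ h₅
  rw [h₁, h₅, Pi.add_apply, h₂, h₃, h₄, Pi.add_apply, mul_add]

theorem tensor_smul_right (c : ℝ) (k : Lp ℝ 2 (volume : Measure α))
    (h : Lp ℝ 2 (volume : Measure β)) : tensor k (c • h) = c • tensor k h := by
  apply Lp.ext
  filter_upwards [coeFn_tensor k (c • h), coeFn_tensor k h, ae_snd (Lp.coeFn_smul c h),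
    Lp.coeFn_smul c (tensor k h)] with z h₁ h₂ h₃ h₄
  rw [h₁, h₄, Pi.smul_apply, h₂, h₃, Pi.smul_apply, mul_smul_comm]

variable [SFinite (volume : Measure α)] [SFinite (volume : Measure β)]

theorem norm_tensor (k : Lp ℝ 2 (volume : Measure α)) (h : Lp ℝ 2 (volume : Measure β)) :
    ‖tensor k h‖ = ‖k‖ * ‖h‖ := by
  rw [← sq_eq_sq₀ (norm_nonneg _) (by positivity), mul_pow, norm_sq_eq_integral_sq,
    norm_sq_eq_integral_sq, norm_sq_eq_integral_sq,
    ← integral_prod_mul (fun x => k x ^ 2) (fun x => h x ^ 2)]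
  refine integral_congr_ae ?_
  filter_upwards [coeFn_tensor k h] with z hz
  rw [hz, mul_pow]

/-- The tensor product as a continuous bilinear map. -/
def tensorL : Lp ℝ 2 (volume : Measure α) →L[ℝ] Lp ℝ 2 (volume : Measure β) →L[ℝ]
    Lp ℝ 2 (volume : Measure (α × β)) :=
  LinearMap.mkContinuous₂
    (LinearMap.mk₂ ℝ tensor tensor_add_left tensor_smul_left tensor_add_right
      fun c k h => tensor_smul_right c k h)
    1 fun k h => by simp [norm_tensor]

/-- The partial scalar product `x ↦ ∫ k(s) u(s, x) ds` of `u` with a function of the first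
variable, defined by duality: it is the adjoint of `h ↦ k ⊗ h`. -/
def partialInner (k : Lp ℝ 2 (volume : Measure α)) :
    Lp ℝ 2 (volume : Measure (α × β)) →L[ℝ] Lp ℝ 2 (volume : Measure β) :=
  (tensorL k).adjoint

theorem inner_partialInner (k : Lp ℝ 2 (volume : Measure α))
    (u : Lp ℝ 2 (volume : Measure (α × β))) (h : Lp ℝ 2 (volume : Measure β)) :
    inner ℝ (partialInner k u) h = inner ℝ u (tensor k h) :=
  ContinuousLinearMap.adjoint_inner_left _ _ _

theorem norm_partialInner_le (k : Lp ℝ 2 (volume : Measure α))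
    (u : Lp ℝ 2 (volume : Measure (α × β))) : ‖partialInner k u‖ ≤ ‖k‖ * ‖u‖ := by
  refine (ContinuousLinearMap.le_opNorm _ _).trans ?_
  gcongr
  rw [partialInner, LinearIsometryEquiv.norm_map]
  exact ContinuousLinearMap.opNorm_le_bound _ (norm_nonneg _) fun h => (norm_tensor k h).le

theorem partialInner_sub (k k' : Lp ℝ 2 (volume : Measure α))
    (u : Lp ℝ 2 (volume : Measure (α × β))) :
    partialInner (k - k') u = partialInner k u - partialInner k' u := by
  simp [partialInner]

theorem continuous_partialInner (u : Lp ℝ 2 (volume : Measure (α × β))) :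
    Continuous fun k => partialInner k u :=
  ((ContinuousLinearMap.adjoint (𝕜 := ℝ) (E := Lp ℝ 2 (volume : Measure β))
    (F := Lp ℝ 2 (volume : Measure (α × β)))).continuous.comp tensorL.continuous).clm_apply
      continuous_const

theorem inner_partialInner_eq_integral (k : Lp ℝ 2 (volume : Measure α))
    (u : Lp ℝ 2 (volume : Measure (α × β))) (h : Lp ℝ 2 (volume : Measure β)) :
    inner ℝ (partialInner k u) h = ∫ z : α × β, u z * (k z.1 * h z.2) := by
  rw [inner_partialInner, real_inner_eq_integral_mul]
  refine integral_congr_ae ?_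
  filter_upwards [coeFn_tensor k h] with z hz
  rw [hz]

theorem inner_partialInner_eq_integral_integral (k : Lp ℝ 2 (volume : Measure α))
    (u : Lp ℝ 2 (volume : Measure (α × β))) (h : Lp ℝ 2 (volume : Measure β)) :
    inner ℝ (partialInner k u) h = ∫ s, k s * ∫ x, u (s, x) * h x := by
  rw [inner_partialInner_eq_integral]
  refine (integral_prod _ (integrable_mul_tensor k u h)).trans ?_
  simp only [← integral_const_mul, mul_left_comm]

theorem coeFn_partialInner [IsFiniteMeasure (volume : Measure β)]
    (k : Lp ℝ 2 (volume : Measure α)) (u : Lp ℝ 2 (volume : Measure (α × β))) :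
    partialInner k u =ᵐ[volume] fun x => ∫ s, u (s, x) * k s := by
  refine Integrable.ae_eq_of_forall_setIntegral_eq _ _ (integrable_coeFn _)
    (integrable_mul_fst u k).integral_prod_right fun A hA _ => ?_
  have indicator_tensor : ∀ᵐ z : α × β,
      u z * (k z.1 * indicatorConstLp 2 hA (measure_ne_top volume A) (1 : ℝ) z.2) =
        A.indicator (fun _ => (1 : ℝ)) z.2 * (u z * k z.1) := by
    filter_upwards [ae_snd (indicatorConstLp_coeFn (p := 2) (hs := hA)
      (hμs := measure_ne_top volume A) (c := (1 : ℝ)))] with z hz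
    rw [hz]; ring
  rw [← L2.inner_indicatorConstLp_one (𝕜 := ℝ) hA (measure_ne_top _ _), real_inner_comm,
    inner_partialInner_eq_integral, integral_congr_ae indicator_tensor, ← integral_indicator hA]
  refine (integral_prod_symm _ ((integrable_mul_tensor k u _).congr indicator_tensor)).trans ?_
  refine integral_congr_ae (Eventually.of_forall fun x => ?_)
  by_cases hx : x ∈ A <;> simp [hx]

theorem ae_memLp_slice (u : Lp ℝ 2 (volume : Measure (α × β))) :
    ∀ᵐ s, MemLp (fun x => u (s, x)) 2 := by
  filter_upwards [Integrable.prod_right_ae (integrable_coeFn_sq u)] with s hs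
  exact (memLp_two_iff_integrable_sq
    ((Lp.stronglyMeasurable u).comp_measurable measurable_prodMk_left).aestronglyMeasurable).2 hs

end Product

section MulLp

variable {X : Type*} [TopologicalSpace X] [CompactSpace X] [MeasurableSpace X] [BorelSpace X]
  {μ : Measure X} [IsFiniteMeasure μ]

/-- The product of a continuous function and a square-integrable function. -/
def mulLp : C(X, ℝ) →L[ℝ] Lp ℝ 2 μ →L[ℝ] Lp ℝ 2 μ :=
  ((ContinuousLinearMap.mul ℝ ℝ).holderL μ ⊤ 2 2).comp (ContinuousMap.toLp ⊤ μ ℝ)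

theorem coeFn_mulLp (f : C(X, ℝ)) (u : Lp ℝ 2 μ) : mulLp f u =ᵐ[μ] fun z => f z * u z := by
  filter_upwards [(ContinuousLinearMap.mul ℝ ℝ).coeFn_holder (r := 2)
    (ContinuousMap.toLp ⊤ μ ℝ f) u, ContinuousMap.coeFn_toLp (𝕜 := ℝ) (p := ⊤) μ f] with z h h'
  rw [← h']
  exact h

theorem inner_mulLp (f : C(X, ℝ)) (u v : Lp ℝ 2 μ) :
    inner ℝ (mulLp f u) v = ∫ z, u z * v z * f z ∂μ := by
  rw [real_inner_eq_integral_mul]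
  refine integral_congr_ae ?_
  filter_upwards [coeFn_mulLp f u] with z hz
  rw [hz]
  ring

theorem inner_mulLp_comm (f : C(X, ℝ)) (u v : Lp ℝ 2 μ) :
    inner ℝ (mulLp f u) v = inner ℝ (mulLp f v) u := by
  simp only [inner_mulLp, mul_comm (u _)]

end MulLp

/-! ### Calculus on the unit interval -/

theorem integral_unitInterval (f : ℝ → ℝ) : ∫ t : I, f t = ∫ s in (0 : ℝ)..1, f s := by
  rw [unitInterval.volume_def, integral_subtype_comap measurableSet_Icc,
    integral_Icc_eq_integral_Ioc, intervalIntegral.integral_of_le zero_le_one]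

theorem integrable_of_continuous {X : Type*} [TopologicalSpace X] [CompactSpace X]
    [MeasurableSpace X] [OpensMeasurableSpace X] {μ : Measure X} [IsFiniteMeasureOnCompacts μ]
    {f : X → ℝ} (hf : Continuous f) : Integrable f μ :=
  hf.integrable_of_hasCompactSupport (HasCompactSupport.of_compactSpace f)

theorem integrable_mul_of_continuous {X : Type*} [TopologicalSpace X] [CompactSpace X]
    [MeasurableSpace X] [OpensMeasurableSpace X] {μ : Measure X} {f g : X → ℝ}
    (hf : Integrable f μ) (hg : Continuous g) : Integrable (fun x => f x * g x) μ := by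
  obtain ⟨C, hC⟩ := isCompact_univ.exists_bound_of_continuousOn hg.continuousOn
  exact hf.mul_bdd hg.aestronglyMeasurable (Eventually.of_forall fun x => hC x (mem_univ x))

section Primitive

variable {v : I → ℝ}

theorem integrableOn_IccExtend (hv : Integrable v) :
    IntegrableOn (IccExtend zero_le_one v) (Icc (0 : ℝ) 1) := by
  refine (unitInterval.measurePreserving_coe.integrable_comp_emb
    unitInterval.measurableEmbedding_coe).1 ?_
  simpa only [Function.comp_def, IccExtend_val] using hv

theorem intervalIntegrable_IccExtend (hv : Integrable v) :
    IntervalIntegrable (IccExtend zero_le_one v) volume (0 : ℝ) 1 :=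
  (intervalIntegrable_iff_integrableOn_Icc_of_le zero_le_one).2 (integrableOn_IccExtend hv)

theorem setIntegral_Iic (v : I → ℝ) (t : I) :
    ∫ s in Iic t, v s = ∫ s in (0 : ℝ)..t, IccExtend zero_le_one v s := by
  have h := unitInterval.measurePreserving_coe.setIntegral_image_emb
    unitInterval.measurableEmbedding_coe (IccExtend zero_le_one v) (Iic t)
  rw [Measure.restrict_restrict_of_subset (image_subset_iff.2 fun s _ => s.2)] at h
  simp only [IccExtend_val] at h
  rw [← h, image_subtype_val_Icc_Iic, integral_Icc_eq_integral_Ioc,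
    intervalIntegral.integral_of_le t.2.1]

/-- The primitive `t ↦ a + ∫₀ᵗ v` of a function on the unit interval. It is defined on the line,
on which derivatives are taken; its values outside of `[0,1]` are not meaningful. -/
def prim (a : ℝ) (v : I → ℝ) (t : ℝ) : ℝ := a + ∫ s in (0 : ℝ)..t, IccExtend zero_le_one v s

theorem prim_coe (a : ℝ) (v : I → ℝ) (t : I) : prim a v t = a + ∫ s in Iic t, v s := by
  rw [prim, setIntegral_Iic]

theorem absolutelyContinuousOnInterval_prim (hv : Integrable v) (a : ℝ) :
    AbsolutelyContinuousOnInterval (prim a v) 0 1 :=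
  (LipschitzWith.const a).lipschitzOnWith.absolutelyContinuousOnInterval.add
    ((intervalIntegrable_IccExtend hv).absolutelyContinuousOnInterval_intervalIntegral (by simp))

theorem continuous_prim_coe (hv : Integrable v) (a : ℝ) : Continuous fun t : I => prim a v t := by
  have h := (absolutelyContinuousOnInterval_prim hv a).continuousOn
  rw [uIcc_of_le zero_le_one] at h
  exact continuousOn_iff_continuous_domRestrict.1 h

theorem ae_hasDerivAt_prim (hv : Integrable v) (a : ℝ) :
    ∀ᵐ t : I, HasDerivAt (prim a v) (v t) t := by
  have h := unitInterval.measurePreserving_coe.quasiMeasurePreserving.ae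
    (ae_restrict_of_ae (intervalIntegrable_IccExtend hv).ae_hasDerivAt_integral)
  filter_upwards [h] with t ht
  have ht' := (ht (by rw [uIcc_of_le zero_le_one]; exact t.2) 0 (by simp)).const_add a
  rwa [IccExtend_val] at ht'

theorem integral_deriv_mul_eq_sub {g F : ℝ → ℝ} {F' : I → ℝ} (hg : ContDiff ℝ 1 g)
    (hF : AbsolutelyContinuousOnInterval F 0 1) (hF' : ∀ᵐ t : I, HasDerivAt F (F' t) t) :
    ∫ t : I, deriv g t * F t = g 1 * F 1 - g 0 * F 0 - ∫ t : I, g t * F' t := by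
  have parts := hg.contDiffOn.absolutelyContinuousOnInterval.integral_mul_deriv_eq_deriv_mul hF
  have deriv_F : ∫ t : I, g t * deriv F t = ∫ t : I, g t * F' t := by
    refine integral_congr_ae ?_
    filter_upwards [hF'] with t ht
    rw [ht.deriv]
  rw [← deriv_F, integral_unitInterval (fun t => deriv g t * F t),
    integral_unitInterval (fun t => g t * deriv F t), parts]
  ring

theorem integral_deriv_mul_prim (hv : Integrable v) (a : ℝ) {g : ℝ → ℝ} (hg : ContDiff ℝ 1 g) :
    ∫ t : I, deriv g t * prim a v t =
      g 1 * prim a v 1 - g 0 * prim a v 0 - ∫ t : I, g t * v t :=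
  integral_deriv_mul_eq_sub hg (absolutelyContinuousOnInterval_prim hv a) (ae_hasDerivAt_prim hv a)

theorem integral_deriv_mul_prim_sq (hv : Integrable v) (a : ℝ) {g : ℝ → ℝ}
    (hg : ContDiff ℝ 1 g) :
    ∫ t : I, deriv g t * prim a v t ^ 2 =
      g 1 * prim a v 1 ^ 2 - g 0 * prim a v 0 ^ 2 - ∫ t : I, g t * (2 * prim a v t * v t) := by
  have hF := absolutelyContinuousOnInterval_prim hv a
  refine integral_deriv_mul_eq_sub hg (F := fun t => prim a v t ^ 2) ?_ ?_
  · simpa only [sq] using hF.fun_mul hF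
  · filter_upwards [ae_hasDerivAt_prim hv a] with t ht
    simpa only [Nat.cast_ofNat, Nat.add_one_sub_one, pow_one] using ht.fun_pow 2

end Primitive

/-- Smooth functions with compact support in `(0,1)`. -/
structure IsTest (θ : ℝ → ℝ) : Prop where
  smooth : ContDiff ℝ ∞ θ
  compact : HasCompactSupport θ
  supp : tsupport θ ⊆ Ioo 0 1

namespace IsTest

variable {θ χ : ℝ → ℝ}

theorem continuous_coe (h : IsTest θ) : Continuous fun t : I => θ t :=
  h.smooth.continuous.comp continuous_subtype_val

theorem continuous_deriv_coe (h : IsTest θ) : Continuous fun t : I => deriv θ t :=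
  (h.smooth.continuous_deriv (by simp)).comp continuous_subtype_val

theorem eq_zero (h : IsTest θ) {t : ℝ} (ht : t ∉ Ioo (0 : ℝ) 1) : θ t = 0 :=
  image_eq_zero_of_notMem_tsupport fun h' => ht (h.supp h')

theorem of_Icc (h : ContDiff ℝ ∞ θ) {a b : ℝ} (ha : 0 < a) (hb : b < 1)
    (h0 : ∀ t, t ∉ Icc a b → θ t = 0) : IsTest θ := by
  have hsupp : tsupport θ ⊆ Icc a b :=
    closure_minimal (fun t ht => by_contra fun h' => ht (h0 t h')) isClosed_Icc
  exact ⟨h, HasCompactSupport.intro isCompact_Icc h0, hsupp.trans (Icc_subset_Ioo ha hb)⟩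

theorem exists_Icc (h : IsTest θ) :
    ∃ a b, 0 < a ∧ b < 1 ∧ ∀ t, t ∉ Icc a b → θ t = 0 := by
  rcases (tsupport θ).eq_empty_or_nonempty with hempty | hne
  · exact ⟨1 / 2, 1 / 2, by norm_num, by norm_num, fun t _ =>
      image_eq_zero_of_notMem_tsupport (by simp [hempty])⟩
  · have hc : IsCompact (tsupport θ) := h.compact
    obtain ⟨a, ha, ha'⟩ := hc.exists_isLeast hne
    obtain ⟨b, hb, hb'⟩ := hc.exists_isGreatest hne
    exact ⟨a, b, (h.supp ha).1, (h.supp hb).2, fun t ht =>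
      image_eq_zero_of_notMem_tsupport fun h' => ht ⟨ha' h', hb' h'⟩⟩

theorem sub (h : IsTest θ) (h' : IsTest χ) : IsTest fun t => θ t - χ t :=
  ⟨h.smooth.sub h'.smooth, h.compact.sub h'.compact,
    (tsupport_sub θ χ).trans (union_subset h.supp h'.supp)⟩

theorem const_mul (c : ℝ) (h : IsTest θ) : IsTest fun t => c * θ t :=
  ⟨contDiff_const.mul h.smooth, h.compact.mul_left, (tsupport_mul_subset_right).trans h.supp⟩

theorem exists_deriv_eq (h : IsTest θ) (h0 : ∫ t in (0 : ℝ)..1, θ t = 0) :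
    ∃ ϑ, IsTest ϑ ∧ deriv ϑ = θ := by
  obtain ⟨a, b, ha, hb, hab⟩ := h.exists_Icc
  have hθ : Continuous θ := h.smooth.continuous
  have integral_eq_zero {x y : ℝ} (hxy : ∀ s ∈ uIcc x y, s ∉ Icc a b) :
      ∫ s in x..y, θ s = 0 :=
    (intervalIntegral.integral_congr fun s hs => hab s (hxy s hs)).trans (by simp)
  have hd (t : ℝ) : HasDerivAt (fun t => ∫ s in (0 : ℝ)..t, θ s) (θ t) t :=
    hθ.integral_hasStrictDerivAt 0 t |>.hasDerivAt
  have hd' : deriv (fun t => ∫ s in (0 : ℝ)..t, θ s) = θ := funext fun t => (hd t).deriv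
  refine ⟨fun t => ∫ s in (0 : ℝ)..t, θ s, of_Icc ?_ ha hb fun t ht => ?_, hd'⟩
  · rw [contDiff_infty_iff_deriv, hd']
    exact ⟨fun t => (hd t).differentiableAt, h.smooth⟩
  rw [mem_Icc, not_and_or, not_le, not_le] at ht
  rcases ht with ht | ht
  · refine integral_eq_zero fun s hs hs' => ?_
    rcases le_max_iff.1 hs.2 with hle | hle <;> linarith [hs'.1]
  · rw [← intervalIntegral.integral_add_adjacent_intervals (b := 1)
      (hθ.intervalIntegrable _ _) (hθ.intervalIntegrable _ _), h0, zero_add]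
    refine integral_eq_zero fun s hs hs' => ?_
    rcases min_le_iff.1 hs.1 with hle | hle <;> linarith [hs'.2]

theorem exists_integral_eq_one : ∃ χ, IsTest χ ∧ ∫ t in (0 : ℝ)..1, χ t = 1 := by
  let φ : ContDiffBump (1 / 2 : ℝ) := ⟨1 / 8, 1 / 4, by norm_num, by norm_num⟩
  have hsupp : tsupport (φ.normed volume) ⊆ Ioo 0 1 := by
    rw [φ.tsupport_normed_eq, Real.closedBall_eq_Icc]
    exact Icc_subset_Ioo (by norm_num [φ]) (by norm_num [φ])
  refine ⟨φ.normed volume, ⟨φ.contDiff_normed, φ.hasCompactSupport_normed, hsupp⟩, ?_⟩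
  rw [intervalIntegral.integral_eq_integral_of_support_subset, φ.integral_normed]
  exact subset_closure.trans (hsupp.trans Ioo_subset_Ioc_self)

end IsTest

theorem ae_eq_zero_of_integral_mul_isTest {D : I → ℝ} (hD : Integrable D)
    (h : ∀ θ, IsTest θ → ∫ t : I, D t * θ t = 0) : ∀ᵐ t, D t = 0 := by
  have hloc : LocallyIntegrableOn (IccExtend zero_le_one D) (Ioo (0 : ℝ) 1) :=
    ((integrableOn_IccExtend hD).mono_set Ioo_subset_Icc_self).locallyIntegrableOn
  have hzero := isOpen_Ioo.ae_eq_zero_of_integral_contDiff_smul_eq_zero hloc fun θ h₁ h₂ h₃ => by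
    have hθ := h θ ⟨h₁, h₂, h₃⟩
    simp only [← IccExtend_val zero_le_one D] at hθ
    rw [integral_unitInterval (fun s => IccExtend zero_le_one D s * θ s),
      intervalIntegral.integral_eq_integral_of_support_subset] at hθ
    · simpa only [smul_eq_mul, mul_comm] using hθ
    · exact (Function.support_mul_subset_right _ _).trans
        (subset_closure.trans (h₃.trans Ioo_subset_Ioc_self))
  have hIcc : ∀ᵐ x ∂(volume.restrict (Icc (0 : ℝ) 1)), IccExtend zero_le_one D x = 0 := by
    rw [← Measure.restrict_congr_set (Ioo_ae_eq_Icc (a := (0 : ℝ)) (b := 1))]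
    rwa [ae_restrict_iff' measurableSet_Ioo]
  have hI := unitInterval.measurePreserving_coe.quasiMeasurePreserving.ae hIcc
  simpa only [IccExtend_val] using hI

/-- **du Bois-Reymond's lemma** -/
theorem ae_eq_integral_of_integral_mul_deriv {D : I → ℝ} (hD : Integrable D)
    (h : ∀ θ, IsTest θ → ∫ t : I, D t * deriv θ t = 0) : ∀ᵐ t, D t = ∫ s, D s := by
  obtain ⟨χ, hχ, hχ_one⟩ := IsTest.exists_integral_eq_one
  set c := ∫ t : I, D t * χ t with hc
  have integrable_mul (θ : ℝ → ℝ) (hθ : IsTest θ) : Integrable fun t : I => D t * θ t :=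
    integrable_mul_of_continuous hD hθ.continuous_coe
  have hconst : ∀ᵐ t, D t - c = 0 := by
    refine ae_eq_zero_of_integral_mul_isTest (hD.sub (integrable_const c)) fun ψ hψ => ?_
    set d := ∫ t : I, ψ t with hd
    obtain ⟨θ, hθ, hθ'⟩ := (hψ.sub (hχ.const_mul d)).exists_deriv_eq (by
      rw [intervalIntegral.integral_sub (hψ.smooth.continuous.intervalIntegrable _ _)
        ((hχ.const_mul d).smooth.continuous.intervalIntegrable _ _),
        intervalIntegral.integral_const_mul, hχ_one, mul_one, hd, integral_unitInterval, sub_self])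
    have hDθ := h θ hθ
    simp only [hθ', mul_sub, mul_left_comm _ d] at hDθ
    rw [integral_sub (integrable_mul ψ hψ) ((integrable_mul χ hχ).const_mul d),
      integral_const_mul, ← hc] at hDθ
    simp only [sub_mul]
    rw [integral_sub (integrable_mul ψ hψ) ((integrable_of_continuous
      hψ.continuous_coe).const_mul c), integral_const_mul, ← hd]
    linarith
  have hD_eq : ∀ᵐ t, D t = c := hconst.mono fun t ht => sub_eq_zero.1 ht
  have hint : ∫ s, D s = c := (integral_congr_ae hD_eq).trans (by simp)
  rwa [hint]

theorem ae_eq_prim_of_weakDeriv {U V : I → ℝ} (hU : Integrable U) (hV : Integrable V)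
    (h : ∀ θ, IsTest θ → ∫ t : I, U t * deriv θ t = -∫ t : I, V t * θ t) :
    ∀ᵐ t : I, U t = prim ((∫ s, U s) + ∫ s : I, V s * ((s : ℝ) - 1)) V t := by
  have hW : Integrable fun t : I => prim 0 V t :=
    integrable_of_continuous (continuous_prim_coe hV 0)
  have hconst := ae_eq_integral_of_integral_mul_deriv (hU.sub hW) fun θ hθ => by
    have parts := integral_deriv_mul_prim hV 0 (hθ.smooth.of_le (by simp))
    rw [hθ.eq_zero (by simp), hθ.eq_zero (t := 0) (by simp)] at parts
    simp only [zero_mul, sub_zero, zero_sub] at parts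
    simp only [Pi.sub_apply, sub_mul]
    rw [integral_sub (integrable_mul_of_continuous hU hθ.continuous_deriv_coe)
      (integrable_mul_of_continuous hW hθ.continuous_deriv_coe), h θ hθ]
    simp only [mul_comm] at parts ⊢
    rw [parts, sub_self]
  have parts := integral_deriv_mul_prim hV 0 (g := fun s => s - 1) (by fun_prop)
  have integral_sub_prim : ∫ s, (U - fun t : I => prim 0 V t) s =
      (∫ s, U s) + ∫ s : I, V s * ((s : ℝ) - 1) := by
    simp only [deriv_sub_const, deriv_id'', one_mul, sub_self, zero_mul, prim,
      intervalIntegral.integral_same, add_zero, mul_zero, zero_sub] at parts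
    simp only [Pi.sub_apply]
    rw [integral_sub hU hW]
    simp only [prim, parts, mul_comm, sub_neg_eq_add]
  rw [integral_sub_prim] at hconst
  filter_upwards [hconst] with t ht
  rw [prim, ← ht, Pi.sub_apply, prim]
  ring

/-! ### Elements of `H¹` are continuous in time -/

/-- A continuous function on `[0,1]` as an element of `L²([0,1])`. -/
abbrev toL2 : C(I, ℝ) →L[ℝ] L2Space := ContinuousMap.toLp 2 volume ℝ

theorem coeFn_toL2 (f : C(I, ℝ)) : toL2 f =ᵐ[volume] f := ContinuousMap.coeFn_toLp _ _

/-- The indicator function of `[0, t]`, whose scalar product with `v` is `∫₀ᵗ v`. -/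
def ind (t : I) : L2Space := indicatorConstLp 2 (measurableSet_Iic (a := t)) (measure_ne_top _ _) 1

theorem coeFn_ind (t : I) : ind t =ᵐ[volume] (Iic t).indicator fun _ => (1 : ℝ) :=
  indicatorConstLp_coeFn

theorem inner_ind (t : I) (h : L2Space) : inner ℝ (ind t) h = ∫ x in Iic t, h x :=
  L2.inner_indicatorConstLp_one _ _ _

theorem integral_mul_ind (t : I) (f : I → ℝ) : ∫ s, f s * ind t s = ∫ s in Iic t, f s := by
  rw [← integral_indicator measurableSet_Iic]
  refine integral_congr_ae ?_
  filter_upwards [coeFn_ind t] with s hs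
  by_cases h : s ∈ Iic t <;> simp [hs, h]

theorem inner_ind_ind {s t : I} (h : s ≤ t) : inner ℝ (ind s) (ind t) = (s : ℝ) := by
  have hst : Iic s ∩ Iic t = Iic s := inter_eq_left.2 (Iic_subset_Iic.2 h)
  rw [inner_ind, integral_congr_ae (ae_restrict_of_ae (coeFn_ind t)),
    setIntegral_indicator measurableSet_Iic, hst]
  simp [Measure.real, s.2.1]

theorem norm_ind_sub (s t : I) : ‖ind t - ind s‖ = √|(t : ℝ) - s| := by
  wlog h : s ≤ t generalizing s t
  · rw [norm_sub_rev, abs_sub_comm, this t s (le_of_not_ge h)]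
  rw [← Real.sqrt_sq (norm_nonneg _), norm_sub_sq_real, ← real_inner_self_eq_norm_sq,
    ← real_inner_self_eq_norm_sq, inner_ind_ind le_rfl, inner_ind_ind le_rfl, real_inner_comm,
    inner_ind_ind h, abs_of_nonneg (sub_nonneg.2 (Subtype.coe_le_coe.2 h))]
  ring_nf

theorem norm_ind_le (t : I) : ‖ind t‖ ≤ 1 := by
  have h : ‖ind t‖ ^ 2 = t := by rw [← real_inner_self_eq_norm_sq, inner_ind_ind le_rfl]
  exact (sq_le_one_iff₀ (norm_nonneg _)).1 (h.trans_le t.2.2)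

theorem continuous_ind : Continuous ind := by
  refine continuous_iff_continuousAt.2 fun s => tendsto_iff_norm_sub_tendsto_zero.2 ?_
  simp only [norm_ind_sub]
  have h : Continuous fun t : I => √|(t : ℝ) - s| := by fun_prop
  simpa using h.tendsto s

/-- The function `s ↦ s - 1`. By an integration by parts, `u(0) = ∫ u(s) ds + ∫ (s - 1) u̇(s) ds`,
which expresses `u(0)` in terms of the classes of `u` and `u̇` in `L²`. -/
def subOne : L2Space := toL2 ⟨fun s => (s : ℝ) - 1, by fun_prop⟩

theorem coeFn_subOne : subOne =ᵐ[volume] fun s : I => (s : ℝ) - 1 := coeFn_toL2 _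

theorem norm_subOne_le : ‖subOne‖ ≤ 1 := by
  refine (Lp.norm_le_of_ae_bound zero_le_one ?_).trans_eq (by simp [measureUnivNNReal])
  filter_upwards [coeFn_subOne] with s hs
  rw [hs, Real.norm_eq_abs, abs_le]
  constructor <;> linarith [s.2.1, s.2.2]

/-- The value at time `0` of the continuous representative of `u`, where `v` is the weak time
derivative of `u`. -/
def initVal (u v : L2Square) : L2Space := partialInner (ind 1) u + partialInner subOne v

/-- The value at time `t` of the continuous representative of `u`, where `v` is the weak time
derivative of `u`. -/
def evalAt (t : I) (u v : L2Square) : L2Space := initVal u v + partialInner (ind t) v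

theorem evalAt_sub (s t : I) (u v : L2Square) :
    evalAt t u v - evalAt s u v = partialInner (ind t - ind s) v := by
  rw [evalAt, evalAt, add_sub_add_left_eq_sub, partialInner_sub]

theorem continuous_evalAt (u v : L2Square) : Continuous fun t => evalAt t u v :=
  continuous_const.add ((continuous_partialInner v).comp continuous_ind)

theorem norm_evalAt_le (t : I) (u v : L2Square) : ‖evalAt t u v‖ ≤ ‖u‖ + 2 * ‖v‖ := by
  have norm_le {k : L2Space} (hk : ‖k‖ ≤ 1) (w : L2Square) : ‖partialInner k w‖ ≤ ‖w‖ :=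
    (norm_partialInner_le k w).trans (mul_le_of_le_one_left (norm_nonneg w) hk)
  calc ‖evalAt t u v‖
      ≤ ‖partialInner (ind 1) u‖ + ‖partialInner subOne v‖ + ‖partialInner (ind t) v‖ :=
        norm_add₃_le
    _ ≤ ‖u‖ + ‖v‖ + ‖v‖ :=
        add_le_add_three (norm_le (norm_ind_le 1) u) (norm_le norm_subOne_le v)
          (norm_le (norm_ind_le t) v)
    _ = ‖u‖ + 2 * ‖v‖ := by ring

theorem inner_evalAt (t : I) (u v : L2Square) (h : L2Space) :
    inner ℝ (evalAt t u v) h =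
      prim ((∫ s, ∫ x, u (s, x) * h x) + ∫ s : I, (∫ x, v (s, x) * h x) * ((s : ℝ) - 1))
        (fun s => ∫ x, v (s, x) * h x) t := by
  have Iic_one : Iic (1 : I) = univ := eq_univ_of_forall fun s => s.2.2
  rw [evalAt, initVal, inner_add_left, inner_add_left, inner_partialInner_eq_integral_integral,
    inner_partialInner_eq_integral_integral, inner_partialInner_eq_integral_integral, prim_coe]
  simp only [mul_comm (ind _ _), integral_mul_ind, Iic_one, Measure.restrict_univ]
  congr 2
  refine integral_congr_ae ?_
  filter_upwards [coeFn_subOne] with s hs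
  rw [hs, mul_comm]

theorem hasDerivAt_timeDeriv {f : ℝ × ℝ → ℝ} (hf : ContDiff ℝ ∞ f) (z : Square) :
    HasDerivAt (fun s : ℝ => f (s, (z.2 : ℝ))) (timeDeriv f z) z.1 := by
  have hf' : HasFDerivAt f (fderiv ℝ f (toPlane z)) (toPlane z) :=
    (hf.differentiable (by simp)).differentiableAt.hasFDerivAt
  exact hf'.comp_hasDerivAt (z.1 : ℝ) ((hasDerivAt_id _).prodMk (hasDerivAt_const _ _))

theorem IsTimeTest.eq_zero {f : ℝ × ℝ → ℝ} (hf : IsTimeTest f) {t x : ℝ}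
    (ht : t ∉ Ioo (0 : ℝ) 1) : f (t, x) = 0 :=
  image_eq_zero_of_notMem_tsupport fun h => ht (hf.2.2 h).1

section TensorTest

variable {θ φ : ℝ → ℝ}

theorem IsTest.isTimeTest_mul (hθ : IsTest θ) (hφ : ContDiff ℝ ∞ φ) (hφ' : HasCompactSupport φ) :
    IsTimeTest fun z => θ z.1 * φ z.2 := by
  have hsupp : (Function.support fun z : ℝ × ℝ => θ z.1 * φ z.2) ⊆ tsupport θ ×ˢ tsupport φ :=
    fun z hz => ⟨subset_closure (left_ne_zero_of_mul hz), subset_closure (right_ne_zero_of_mul hz)⟩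
  have hK : IsCompact (tsupport θ ×ˢ tsupport φ) := IsCompact.prod hθ.compact hφ'
  exact ⟨(hθ.smooth.comp contDiff_fst).mul (hφ.comp contDiff_snd),
    HasCompactSupport.of_support_subset_isCompact hK hsupp,
    (closure_minimal hsupp hK.isClosed).trans (prod_mono hθ.supp (subset_univ _))⟩

theorem timeDeriv_mul (hθ : IsTest θ) (hφ : ContDiff ℝ ∞ φ) (z : Square) :
    timeDeriv (fun z => θ z.1 * φ z.2) z = deriv θ z.1 * φ z.2 :=
  (hasDerivAt_timeDeriv ((hθ.smooth.comp contDiff_fst).mul (hφ.comp contDiff_snd)) z).unique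
    ((hθ.smooth.differentiable (by simp)).differentiableAt.hasDerivAt.mul_const (φ z.2))

theorem mem_of_isClosed_of_contDiff {A : Set C(I, ℝ)} (hA : IsClosed A)
    (h : ∀ (φ : ℝ → ℝ) (hφ : ContDiff ℝ ∞ φ), HasCompactSupport φ →
      ⟨fun x : I => φ x, hφ.continuous.comp continuous_subtype_val⟩ ∈ A) (f : C(I, ℝ)) :
    f ∈ A := by
  have hf : f ∈ (polynomialFunctions I).topologicalClosure := by
    rw [polynomialFunctions_closure_eq_top]
    trivial
  refine closure_minimal ?_ hA hf
  rintro _ ⟨P, _, rfl⟩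
  let cutoff : ContDiffBump (0 : ℝ) := ⟨2, 3, by norm_num, by norm_num⟩
  have cutoff_coe (x : I) : cutoff (x : ℝ) = 1 := by
    refine cutoff.one_of_mem_closedBall ?_
    rw [Real.closedBall_eq_Icc]
    constructor <;> norm_num [cutoff] <;> linarith [x.2.1, x.2.2]
  have hP : ContDiff ℝ ∞ fun x => cutoff x * P.eval x :=
    cutoff.contDiff.mul (by simpa using P.contDiff_aeval (𝕜 := ℝ) ∞)
  convert h _ hP cutoff.hasCompactSupport.mul_right using 1
  ext x
  simp [cutoff_coe]

end TensorTest

theorem IsWeakTimeDeriv.partialInner_deriv {u v : L2Square} (huv : IsWeakTimeDeriv u v)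
    {θ : ℝ → ℝ} (hθ : IsTest θ) :
    partialInner (toL2 ⟨fun t => deriv θ t, hθ.continuous_deriv_coe⟩) u =
      -partialInner (toL2 ⟨fun t => θ t, hθ.continuous_coe⟩) v := by
  refine ext_inner_right ℝ fun h => ?_
  have dense := ContinuousMap.toLp_denseRange ℝ (volume : Measure I) ℝ (p := 2) (by simp)
  refine dense.induction_on (p := fun h => inner ℝ _ h = inner ℝ _ h) h
    (isClosed_eq (by fun_prop) (by fun_prop)) ?_
  refine mem_of_isClosed_of_contDiff (A := {g | inner ℝ _ (toL2 g) = inner ℝ _ (toL2 g)})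
    (isClosed_eq (by fun_prop) (by fun_prop)) fun φ hφ hφ' => ?_
  have hf := huv _ (hθ.isTimeTest_mul hφ hφ')
  simp only [timeDeriv_mul hθ hφ, toPlane] at hf
  have inner_eq (w : L2Square) (k g : C(I, ℝ)) :
      inner ℝ (partialInner (toL2 k) w) (toL2 g) = ∫ z : Square, w z * (k z.1 * g z.2) := by
    rw [inner_partialInner_eq_integral]
    refine integral_congr_ae ?_
    filter_upwards [ae_fst (coeFn_toL2 k), ae_snd (coeFn_toL2 g)] with z hk hg
    rw [hk, hg]
  rw [mem_ofPred_eq, inner_neg_left, inner_eq, inner_eq]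
  exact hf

theorem IsWeakTimeDeriv.ae_inner_evalAt {u v : L2Square} (huv : IsWeakTimeDeriv u v)
    (h : L2Space) : ∀ᵐ t : I, ∫ x, u (t, x) * h x = inner ℝ (evalAt t u v) h := by
  have integral_mul_toL2 (w : L2Square) (k : C(I, ℝ)) :
      ∫ t, (∫ x, w (t, x) * h x) * k t = inner ℝ (partialInner (toL2 k) w) h := by
    rw [inner_partialInner_eq_integral_integral]
    refine integral_congr_ae ?_
    filter_upwards [coeFn_toL2 k] with t ht
    rw [ht, mul_comm]
  simp only [inner_evalAt]
  refine ae_eq_prim_of_weakDeriv (integrable_mul_snd u h).integral_prod_left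
    (integrable_mul_snd v h).integral_prod_left fun θ hθ => ?_
  have key := integral_mul_toL2 u ⟨_, hθ.continuous_deriv_coe⟩
  rw [huv.partialInner_deriv hθ, inner_neg_left, ← integral_mul_toL2] at key
  exact key

theorem isContinuousRep_evalAt {u v : L2Square} (huv : IsWeakTimeDeriv u v) :
    IsContinuousRep u fun t => evalAt t u v := by
  classical
  have : Fact ((2 : ℝ≥0∞) ≠ ⊤) := ⟨ENNReal.ofNat_ne_top⟩
  refine ⟨continuous_evalAt u v, ?_⟩
  let slice (t : I) : L2Space := if h : MemLp (fun x => u (t, x)) 2 then h.toLp else 0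
  have coeFn_slice : ∀ᵐ t, slice t =ᵐ[volume] fun x => u (t, x) := by
    filter_upwards [ae_memLp_slice u] with t ht
    simpa only [slice, dif_pos ht] using ht.coeFn_toLp
  have hzero : ∀ᵐ t, slice t - evalAt t u v = 0 := by
    refine ae_eq_zero_of_forall_inner (𝕜 := ℝ) fun h => ?_
    filter_upwards [huv.ae_inner_evalAt h, coeFn_slice] with t ht hslice
    rw [Pi.zero_apply, real_inner_comm, inner_sub_left, ← ht, real_inner_eq_integral_mul,
      sub_eq_zero]
    refine integral_congr_ae ?_
    filter_upwards [hslice] with x hx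
    rw [hx]
  filter_upwards [hzero, coeFn_slice] with t ht hslice
  rwa [← sub_eq_zero.1 ht]

theorem isOpenPosMeasure_unitInterval : (volume : Measure I).IsOpenPosMeasure := by
  refine ⟨fun U hU hne => ?_⟩
  obtain ⟨a, b, hab, hsub⟩ := hU.exists_Ioo_subset hne
  refine (lt_of_lt_of_le ?_ (measure_mono hsub)).ne'
  simpa using hab

theorem IsContinuousRep.unique {u : L2Square} {c c' : I → L2Space} (h : IsContinuousRep u c)
    (h' : IsContinuousRep u c') : c = c' := by
  have := isOpenPosMeasure_unitInterval
  refine (Continuous.ae_eq_iff_eq volume h.1 h'.1).1 ?_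
  filter_upwards [h.2, h'.2] with t ht ht'
  exact Lp.ext (ht.trans ht'.symm)

/-- The pointwise primitive of `v` in time with value `a` at time `0`. -/
def timePrim (a : I → ℝ) (v : Square → ℝ) (z : Square) : ℝ :=
  prim (a z.2) (fun s => v (s, z.2)) z.1

theorem coeFn_evalAt (t : I) (u v : L2Square) :
    evalAt t u v =ᵐ[volume] fun x => timePrim (initVal u v) v (t, x) := by
  filter_upwards [Lp.coeFn_add (initVal u v) (partialInner (ind t) v),
    coeFn_partialInner (ind t) v] with x hadd hpartial
  rw [evalAt, hadd, Pi.add_apply, hpartial, integral_mul_ind, timePrim, prim_coe]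

theorem stronglyMeasurable_timePrim {a : I → ℝ} (ha : StronglyMeasurable a) {v : Square → ℝ}
    (hv : StronglyMeasurable v) : StronglyMeasurable (timePrim a v) := by
  have hS : MeasurableSet {p : Square × I | p.2 ≤ p.1.1} :=
    measurableSet_le measurable_snd (measurable_fst.comp measurable_fst)
  have hv' : StronglyMeasurable fun p : Square × I => v (p.2, p.1.2) :=
    hv.comp_measurable (measurable_snd.prodMk (measurable_snd.comp measurable_fst))
  have timePrim_eq : timePrim a v = fun z => a z.2 +
      ∫ s : I, {p : Square × I | p.2 ≤ p.1.1}.indicator (fun p => v (p.2, p.1.2)) (z, s) := by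
    funext z
    rw [timePrim, prim_coe, ← integral_indicator measurableSet_Iic]
    rfl
  rw [timePrim_eq]
  exact (ha.comp_measurable measurable_snd).add (hv'.indicator hS).integral_prod_right'

theorem ae_eq_timePrim {u v : L2Square} (huv : IsWeakTimeDeriv u v) :
    ∀ᵐ z, u z = timePrim (initVal u v) v z := by
  have hm : MeasurableSet {z | u z = timePrim (initVal u v) v z} :=
    measurableSet_eq_fun (Lp.stronglyMeasurable u).measurable
      (stronglyMeasurable_timePrim (Lp.stronglyMeasurable _)
        (Lp.stronglyMeasurable v)).measurable
  refine (Measure.ae_prod_mem_iff_ae_ae_mem hm).2 ?_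
  filter_upwards [(isContinuousRep_evalAt huv).2] with t ht
  filter_upwards [ht, coeFn_evalAt t u v] with x hrep heval
  exact hrep.symm.trans heval

theorem integral_timeDeriv_mul_sq {u v : L2Square} (huv : IsWeakTimeDeriv u v) {f : ℝ × ℝ → ℝ}
    (hf : IsTimeTest f) :
    ∫ z, u z ^ 2 * timeDeriv f z = -∫ z, 2 * (u z * v z) * f (toPlane z) := by
  have integral_swap {w g : Square → ℝ} (hw : Integrable w) (hg : Continuous g) :
      ∫ z, w z * g z = ∫ x, ∫ t, w (t, x) * g (t, x) :=
    integral_prod_symm _ (integrable_mul_of_continuous hw hg)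
  rw [integral_swap (integrable_coeFn_sq u) hf.continuous_timeDeriv,
    integral_swap ((integrable_coeFn_mul u v).const_mul 2) hf.continuous_comp, ← integral_neg]
  refine integral_congr_ae ?_
  filter_upwards [ae_ae_of_ae_prod_symm (ae_eq_timePrim huv),
    Integrable.prod_left_ae (integrable_coeFn v)] with x hu hv
  have hg : ContDiff ℝ 1 fun s : ℝ => f (s, (x : ℝ)) :=
    (hf.1.of_le (by simp)).comp (contDiff_id.prodMk contDiff_const)
  have parts := integral_deriv_mul_prim_sq hv (initVal u v x) hg
  rw [hf.eq_zero (by simp), hf.eq_zero (by simp)] at parts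
  simp only [zero_mul, sub_zero, zero_sub] at parts
  calc ∫ t, u (t, x) ^ 2 * timeDeriv f (t, x)
      = ∫ t : I, deriv (fun s : ℝ => f (s, (x : ℝ))) t *
          prim (initVal u v x) (fun s => v (s, x)) t ^ 2 := by
        refine integral_congr_ae ?_
        filter_upwards [hu] with t ht
        rw [ht, timePrim, (hasDerivAt_timeDeriv hf.1 (t, x)).deriv, mul_comm]
    _ = _ := parts
    _ = -∫ t, 2 * (u (t, x) * v (t, x)) * f (toPlane (t, x)) := by
        refine congrArg Neg.neg (integral_congr_ae ?_)
        filter_upwards [hu] with t ht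
        rw [ht, timePrim, toPlane]
        ring

/-! ### Duality for the Fisher-Rao functional -/

/-- The linear form `L` on continuous functions is dominated by `(μ, ν)`: the quadratic form
`∫ g² dμ - L(gh) + ∫ h² dν` is nonnegative. When `L` is the integral against the signed measure
`τ`, this is the dual form of the inequalities `FR_f(μ, τ) ≤ ∫ f dν`, with `f = h²`. -/
def IsDominated {X : Type*} [TopologicalSpace X] [MeasurableSpace X] (L : C(X, ℝ) →ₗ[ℝ] ℝ)
    (μ ν : Measure X) : Prop :=
  ∀ g h : C(X, ℝ), L (g * h) ≤ (∫ z, g z ^ 2 ∂μ) + ∫ z, h z ^ 2 ∂ν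

namespace IsDominated

variable {X : Type*} [TopologicalSpace X] [MeasurableSpace X] {μ ν μ' ν' : Measure X}
  {L L' : C(X, ℝ) →ₗ[ℝ] ℝ}

theorem sq_le (h : IsDominated L μ ν) (g k : C(X, ℝ)) :
    L (g * k) ^ 2 ≤ 4 * (∫ z, g z ^ 2 ∂μ) * ∫ z, k z ^ 2 ∂ν := by
  have hdiscrim := discrim_le_zero (a := ∫ z, g z ^ 2 ∂μ) (b := -L (g * k))
    (c := ∫ z, k z ^ 2 ∂ν) fun a => by
      have ha := h (a • g) k
      simp only [ContinuousMap.coe_smul, Pi.smul_apply, smul_eq_mul, mul_pow,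
        smul_mul_assoc, map_smul, integral_const_mul] at ha
      linarith
  rw [discrim, neg_sq] at hdiscrim
  linarith

theorem add [CompactSpace X] [OpensMeasurableSpace X] [IsFiniteMeasure μ] [IsFiniteMeasure ν]
    [IsFiniteMeasure μ'] [IsFiniteMeasure ν'] (h : IsDominated L μ ν) (h' : IsDominated L' μ' ν') :
    IsDominated (L + L') (μ + μ') (ν + ν') := by
  intro g k
  have hsq (f : C(X, ℝ)) (m : Measure X) [IsFiniteMeasure m] : Integrable (fun z => f z ^ 2) m :=
    integrable_of_continuous (by fun_prop)
  rw [integral_add_measure (hsq g μ) (hsq g μ'), integral_add_measure (hsq k ν) (hsq k ν'),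
    LinearMap.add_apply]
  linarith [h g k, h' g k]

end IsDominated

section Density

variable {X : Type*} [TopologicalSpace X] [CompactSpace X] [MeasurableSpace X] [BorelSpace X]
  {μ ν : Measure X} [IsFiniteMeasure μ]

theorem inner_toLp (y : Lp ℝ 2 μ) (g : C(X, ℝ)) :
    inner ℝ y (ContinuousMap.toLp 2 μ ℝ g) = ∫ z, y z * g z ∂μ := by
  rw [real_inner_eq_integral_mul]
  refine integral_congr_ae ?_
  filter_upwards [ContinuousMap.coeFn_toLp (𝕜 := ℝ) (p := 2) μ g] with z hz
  rw [hz]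

theorem norm_toLp_sq (g : C(X, ℝ)) :
    ‖ContinuousMap.toLp (E := ℝ) 2 μ ℝ g‖ ^ 2 = ∫ z, g z ^ 2 ∂μ := by
  rw [norm_sq_eq_integral_sq]
  refine integral_congr_ae ?_
  filter_upwards [ContinuousMap.coeFn_toLp (𝕜 := ℝ) (p := 2) μ g] with z hz
  rw [hz]

variable [NormalSpace X] [μ.WeaklyRegular]

theorem exists_forall_eq_integral_mul {L : C(X, ℝ) →ₗ[ℝ] ℝ} {C : ℝ}
    (hL : ∀ g, |L g| ≤ C * ‖ContinuousMap.toLp (E := ℝ) 2 μ ℝ g‖) :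
    ∃ y : Lp ℝ 2 μ, ∀ g : C(X, ℝ), L g = ∫ z, y z * g z ∂μ := by
  let e : C(X, ℝ) →ₗ[ℝ] Lp ℝ 2 μ := (ContinuousMap.toLp 2 μ ℝ).toLinearMap
  have dense : DenseRange e := ContinuousMap.toLp_denseRange ℝ μ ℝ (p := 2) (by simp)
  refine ⟨(InnerProductSpace.toDual ℝ (Lp ℝ 2 μ)).symm (L.extendOfNorm e), fun g => ?_⟩
  rw [← inner_toLp, InnerProductSpace.toDual_symm_apply]
  exact (LinearMap.extendOfNorm_eq dense ⟨C, hL⟩ g).symm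

/-- The quadratic inequality is extended by density to `h = √f` and `g = √f y / 2`. -/
theorem integral_sq_div_four_mul_le {y : Lp ℝ 2 μ}
    (hy : ∀ g h : C(X, ℝ), ∫ z, y z * (g z * h z) ∂μ ≤ (∫ z, g z ^ 2 ∂μ) + ∫ z, h z ^ 2 ∂ν)
    (f : C(X, ℝ)) (hf : ∀ z, 0 ≤ f z) : ∫ z, y z ^ 2 / 4 * f z ∂μ ≤ ∫ z, f z ∂ν := by
  let s : C(X, ℝ) := ⟨fun z => √(f z), by fun_prop⟩
  have hs (z : X) : s z ^ 2 = f z := Real.sq_sqrt (hf z)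
  set Y := mulLp s y
  have inner_le (G : Lp ℝ 2 μ) : inner ℝ Y G ≤ ‖G‖ ^ 2 + ∫ z, f z ∂ν := by
    have dense := ContinuousMap.toLp_denseRange ℝ μ ℝ (p := 2) (by simp)
    refine dense.induction_on (p := fun G => inner ℝ Y G ≤ ‖G‖ ^ 2 + ∫ z, f z ∂ν) G
      (isClosed_le (by fun_prop) (by fun_prop)) fun g => ?_
    have hgs := hy g s
    simp only [hs] at hgs
    rw [norm_toLp_sq, inner_toLp]
    refine (integral_congr_ae ?_).trans_le hgs
    filter_upwards [coeFn_mulLp s y] with z hz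
    rw [hz]
    ring
  have norm_Y_sq : ‖Y‖ ^ 2 / 4 = ∫ z, y z ^ 2 / 4 * f z ∂μ := by
    rw [norm_sq_eq_integral_sq, ← integral_div]
    refine integral_congr_ae ?_
    filter_upwards [coeFn_mulLp s y] with z hz
    rw [hz, mul_pow, hs]
    ring
  have half := inner_le ((1 / 2 : ℝ) • Y)
  rw [inner_smul_right, real_inner_self_eq_norm_sq, norm_smul, mul_pow, Real.norm_eq_abs,
    abs_of_pos one_half_pos] at half
  linarith

theorem IsDominated.exists_density [IsFiniteMeasure ν] {L : C(X, ℝ) →ₗ[ℝ] ℝ}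
    (h : IsDominated L μ ν) :
    ∃ y : Lp ℝ 2 μ, (∀ g : C(X, ℝ), L g = ∫ z, y z * g z ∂μ) ∧
      ∀ f : C(X, ℝ), (∀ z, 0 ≤ f z) →
        ∫⁻ z, ENNReal.ofReal (y z ^ 2 / 4) * ENNReal.ofReal (f z) ∂μ ≤
          ∫⁻ z, ENNReal.ofReal (f z) ∂ν := by
  obtain ⟨y, hy⟩ := exists_forall_eq_integral_mul (μ := μ) (L := L) (C := 2 * √(ν.real univ))
    fun g => by
      have hg := h.sq_le g 1
      simp only [mul_one, ← norm_toLp_sq, ContinuousMap.one_apply, one_pow, integral_const,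
        smul_eq_mul] at hg
      refine abs_le_of_sq_le_sq ?_ (by positivity)
      rw [mul_pow, mul_pow, Real.sq_sqrt measureReal_nonneg]
      linarith
  refine ⟨y, hy, fun f hf => ?_⟩
  have hle := integral_sq_div_four_mul_le (fun g k => (hy (g * k)).symm.trans_le (h g k)) f hf
  have hint : Integrable (fun z => y z ^ 2 / 4 * f z) μ :=
    integrable_mul_of_continuous ((integrable_coeFn_sq y).div_const 4) f.continuous
  simp only [← ENNReal.ofReal_mul (div_nonneg (sq_nonneg _) zero_le_four)]
  rw [← ofReal_integral_eq_lintegral_ofReal hint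
      (Eventually.of_forall fun z => mul_nonneg (by positivity) (hf z)),
    ← ofReal_integral_eq_lintegral_ofReal (integrable_of_continuous f.continuous)
      (Eventually.of_forall hf)]
  exact ENNReal.ofReal_le_ofReal hle

end Density

theorem signedIntegral_eq_rnDeriv {τ : SignedMeasure Square} {μ : Measure Square}
    [IsFiniteMeasure μ] (hτ : τ.totalVariation ≪ μ) {f : Square → ℝ} (hf : Continuous f) :
    signedIntegral τ f = ∫ z, τ.rnDeriv μ z * f z ∂μ := by
  have hpos : τ.toJordanDecomposition.posPart ≪ μ :=
    (Measure.absolutelyContinuous_of_le (Measure.le_add_right le_rfl)).trans hτ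
  have hneg : τ.toJordanDecomposition.negPart ≪ μ :=
    (Measure.absolutelyContinuous_of_le (Measure.le_add_left le_rfl)).trans hτ
  rw [signedIntegral, ← integral_rnDeriv_smul hpos, ← integral_rnDeriv_smul hneg]
  simp only [smul_eq_mul]
  rw [← integral_sub (integrable_mul_of_continuous Measure.integrable_toReal_rnDeriv hf)
    (integrable_mul_of_continuous Measure.integrable_toReal_rnDeriv hf)]
  simp only [SignedMeasure.rnDeriv_def, sub_mul]

theorem signedIntegral_withDensityᵥ {μ : Measure Square} [IsFiniteMeasure μ] {y : Square → ℝ}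
    (hy : Integrable y μ) {f : Square → ℝ} (hf : Continuous f) :
    signedIntegral (μ.withDensityᵥ y) f = ∫ z, y z * f z ∂μ := by
  have hac : SignedMeasure.totalVariation (μ.withDensityᵥ y) ≪ μ := by
    have h := Measure.withDensityᵥ_absolutelyContinuous μ y
    rwa [SignedMeasure.absolutelyContinuous_ennreal_iff,
      VectorMeasure.ennrealToMeasure_toENNRealVectorMeasure] at h
  rw [signedIntegral_eq_rnDeriv hac hf]
  refine integral_congr_ae ?_
  filter_upwards [SignedMeasure.eq_rnDeriv (s := μ.withDensityᵥ y) 0 y hy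
    VectorMeasure.MutuallySingular.zero_left (zero_add _).symm] with z hz
  rw [hz]

/-- Integration against a signed measure, as a linear form on continuous functions. -/
def signedIntegralL (τ : SignedMeasure Square) : C(Square, ℝ) →ₗ[ℝ] ℝ where
  toFun f := signedIntegral τ f
  map_add' f g := by
    simp only [signedIntegral, ContinuousMap.add_apply]
    have integral_add (m : Measure Square) [IsFiniteMeasure m] :
        ∫ z, f z + g z ∂m = (∫ z, f z ∂m) + ∫ z, g z ∂m :=
      MeasureTheory.integral_add (integrable_of_continuous f.continuous)
        (integrable_of_continuous g.continuous)
    rw [integral_add, integral_add]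
    ring
  map_smul' c f := by
    simp only [signedIntegral, ContinuousMap.smul_apply, smul_eq_mul, integral_const_mul, mul_sub,
      RingHom.id_apply]

theorem measurable_rFun : Measurable fun p : ℝ × ℝ => rFun p.1 p.2 := by
  unfold rFun
  refine Measurable.ite (measurableSet_lt measurable_const measurable_fst) (by fun_prop)
    (Measurable.ite ?_ measurable_const measurable_const)
  exact (measurableSet_eq_fun measurable_fst measurable_const).inter
    (measurableSet_eq_fun measurable_snd measurable_const)

theorem mul_le_add_rFun {x y : ℝ} (hr : rFun x y ≠ ⊤) (g h : ℝ) :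
    y * (g * h) ≤ x * g ^ 2 + h ^ 2 * (rFun x y).toReal := by
  unfold rFun at hr ⊢
  split_ifs at hr ⊢ with hx h0
  · rw [ENNReal.toReal_ofReal (by positivity)]
    have complete_square : x * g ^ 2 + h ^ 2 * (y ^ 2 / (4 * x)) - y * (g * h) =
        (2 * g * x - h * y) ^ 2 / (4 * x) := by
      field_simp
      ring
    have : 0 ≤ (2 * g * x - h * y) ^ 2 / (4 * x) := by positivity
    linarith
  · simp [h0.1, h0.2]
  · exact absurd rfl hr

theorem rFun_self_mul {x : ℝ} (hx : 0 ≤ x) (y : ℝ) :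
    rFun x (x * y) = ENNReal.ofReal (x * (y ^ 2 / 4)) := by
  rcases hx.eq_or_lt with rfl | hpos
  · simp [rFun]
  · rw [rFun, if_pos hpos]
    congr 1
    field_simp

theorem signedIntegral_mul_le {μ : Measure Square} [IsFiniteMeasure μ] {τ : SignedMeasure Square}
    {f g h : C(Square, ℝ)} (hf : ∀ z, 0 < f z) (hfh : ∀ z, h z ^ 2 ≤ f z)
    (htop : fisherRao f μ τ ≠ ⊤) :
    signedIntegral τ ⇑(g * h) ≤ (∫ z, g z ^ 2 ∂μ) + (fisherRao f μ τ).toReal := by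
  set l := μ + τ.totalVariation with hl
  have : IsFiniteMeasure l := by rw [hl]; infer_instance
  have : μ.HaveLebesgueDecomposition l := Measure.haveLebesgueDecomposition_of_finiteMeasure
  have hμ : μ ≪ l := Measure.absolutelyContinuous_of_le (Measure.le_add_right le_rfl)
  have hτ : τ.totalVariation ≪ l :=
    Measure.absolutelyContinuous_of_le (Measure.le_add_left le_rfl)
  set x : Square → ℝ := fun z => (μ.rnDeriv l z).toReal
  set y : Square → ℝ := τ.rnDeriv l
  have hF : Measurable fun z => rFun (x z) (y z) * ENNReal.ofReal (f z) :=
    (measurable_rFun.comp ((Measure.measurable_rnDeriv _ _).ennreal_toReal.prodMk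
      (SignedMeasure.measurable_rnDeriv _ _))).mul (by fun_prop)
  have hlt := ae_lt_top hF htop
  have toReal_fisherRao : (fisherRao f μ τ).toReal =
      ∫ z, (rFun (x z) (y z) * ENNReal.ofReal (f z)).toReal ∂l :=
    (integral_toReal hF.aemeasurable hlt).symm
  have hxg : Integrable (fun z => x z * g z ^ 2) l :=
    integrable_mul_of_continuous Measure.integrable_toReal_rnDeriv (g.continuous.pow 2)
  have hr : Integrable (fun z => (rFun (x z) (y z) * ENNReal.ofReal (f z)).toReal) l :=
    integrable_toReal_of_lintegral_ne_top hF.aemeasurable htop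
  have hygh : Integrable (fun z => y z * (g z * h z)) l :=
    integrable_mul_of_continuous (SignedMeasure.integrable_rnDeriv _ _) (g * h).continuous
  rw [signedIntegral_eq_rnDeriv hτ (g * h).continuous, ← integral_rnDeriv_smul hμ,
    toReal_fisherRao]
  refine (integral_mono_ae hygh (hxg.add hr) ?_).trans_eq (integral_add hxg hr)
  filter_upwards [hlt] with z hz
  have hne : rFun (x z) (y z) ≠ ⊤ := by
    intro hrtop
    rw [hrtop, ENNReal.top_mul (by simpa using hf z)] at hz
    exact lt_irrefl _ hz
  refine (mul_le_add_rFun hne (g z) (h z)).trans ?_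
  rw [Pi.add_apply, ENNReal.toReal_mul, ENNReal.toReal_ofReal (hf z).le,
    mul_comm (rFun _ _).toReal]
  gcongr
  exact hfh z

theorem isDominated_signedIntegralL {μ ν : Measure Square} [IsFiniteMeasure μ] [IsFiniteMeasure ν]
    {τ : SignedMeasure Square}
    (hτ : ∀ f : C(Square, ℝ), (∀ z, 0 < f z) →
      fisherRao f μ τ ≤ ∫⁻ z, ENNReal.ofReal (f z) ∂ν) :
    IsDominated (signedIntegralL τ) μ ν := by
  intro g h
  have hsq : Integrable (fun z => h z ^ 2) ν := integrable_of_continuous (by fun_prop)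
  have le_add_const (ε : ℝ) (hε : 0 < ε) : signedIntegralL τ (g * h) ≤
      (∫ z, g z ^ 2 ∂μ) + ((∫ z, h z ^ 2 ∂ν) + ν.real univ * ε) := by
    let f : C(Square, ℝ) := ⟨fun z => h z ^ 2 + ε, by fun_prop⟩
    have hf (z : Square) : 0 < f z := add_pos_of_nonneg_of_pos (sq_nonneg (h z)) hε
    have hFR := hτ f hf
    rw [← ofReal_integral_eq_lintegral_ofReal (integrable_of_continuous f.continuous)
      (Eventually.of_forall fun z => (hf z).le)] at hFR
    refine (signedIntegral_mul_le hf (fun z => le_add_of_nonneg_right hε.le)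
      (ne_top_of_le_ne_top ENNReal.ofReal_ne_top hFR)).trans ?_
    gcongr
    refine (ENNReal.toReal_le_of_le_ofReal (integral_nonneg fun z => (hf z).le) hFR).trans_eq ?_
    refine (integral_add hsq (integrable_const ε)).trans ?_
    rw [integral_const, smul_eq_mul]
  have hlim : Tendsto (fun ε => (∫ z, g z ^ 2 ∂μ) + ((∫ z, h z ^ 2 ∂ν) + ν.real univ * ε))
      (𝓝[>] 0) (𝓝 ((∫ z, g z ^ 2 ∂μ) + ((∫ z, h z ^ 2 ∂ν) + ν.real univ * 0))) :=
    Tendsto.mono_left (Continuous.tendsto (by fun_prop) 0) nhdsWithin_le_nhds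
  rw [mul_zero, add_zero] at hlim
  exact ge_of_tendsto hlim (eventually_mem_nhdsWithin.mono le_add_const)

theorem fisherRao_withDensityᵥ_le {μ : Measure Square} [IsFiniteMeasure μ] {y : Square → ℝ}
    (hy : Measurable y) (hyi : Integrable y μ) (f : C(Square, ℝ)) :
    fisherRao f μ (μ.withDensityᵥ y) ≤
      ∫⁻ z, ENNReal.ofReal (y z ^ 2 / 4) * ENNReal.ofReal (f z) ∂μ := by
  rw [fisherRao]
  set l := μ + SignedMeasure.totalVariation (μ.withDensityᵥ y) with hl
  have : IsFiniteMeasure l := by rw [hl]; infer_instance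
  have : μ.HaveLebesgueDecomposition l := Measure.haveLebesgueDecomposition_of_finiteMeasure
  have hμ : μ ≪ l := Measure.absolutelyContinuous_of_le (Measure.le_add_right le_rfl)
  have hlt : ∀ᵐ z ∂l, μ.rnDeriv l z < ⊤ := Measure.rnDeriv_lt_top μ l
  have hint : Integrable (fun z => (μ.rnDeriv l z).toReal • y z) l :=
    (integrable_rnDeriv_smul_iff hμ).2 hyi
  have density_eq :
      μ.withDensityᵥ y = 0 + l.withDensityᵥ fun z => (μ.rnDeriv l z).toReal • y z := by
    rw [withDensityᵥ_smul_eq_withDensityᵥ_withDensity'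
      (Measure.measurable_rnDeriv _ _).aemeasurable hlt hint,
      Measure.withDensity_rnDeriv_eq μ l hμ, zero_add]
  have rnDeriv_eq := SignedMeasure.eq_rnDeriv 0 _ hint
    VectorMeasure.MutuallySingular.zero_left density_eq
  rw [← lintegral_rnDeriv_mul hμ (by fun_prop)]
  refine (lintegral_congr_ae ?_).le
  filter_upwards [hlt, rnDeriv_eq] with z hz hrn
  rw [← hrn, smul_eq_mul, rFun_self_mul ENNReal.toReal_nonneg,
    ENNReal.ofReal_mul ENNReal.toReal_nonneg, ENNReal.ofReal_toReal hz.ne, mul_assoc]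

/-- The restriction of a test function to the square. -/
abbrev IsTimeTest.restrict {f : ℝ × ℝ → ℝ} (hf : IsTimeTest f) : C(Square, ℝ) :=
  ⟨fun z => f (toPlane z), hf.continuous_comp⟩

/-- The distributional time derivative of `μ` is the linear form `L`. -/
def IsTimeDerivForm (μ : Measure Square) (L : C(Square, ℝ) →ₗ[ℝ] ℝ) : Prop :=
  ∀ (f : ℝ × ℝ → ℝ) (hf : IsTimeTest f), ∫ z, timeDeriv f z ∂μ = -L hf.restrict

theorem fisherRaoLE_iff_exists_isDominated {μ ν : Measure Square} [IsFiniteMeasure μ]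
    [IsFiniteMeasure ν] : FisherRaoLE μ ν ↔ ∃ L, IsDominated L μ ν ∧ IsTimeDerivForm μ L := by
  constructor
  · rintro ⟨τ, hτ, hle⟩
    exact ⟨signedIntegralL τ, isDominated_signedIntegralL hle, hτ⟩
  · rintro ⟨L, hL, hL'⟩
    obtain ⟨y, hy, hle⟩ := hL.exists_density
    refine ⟨μ.withDensityᵥ y, fun f hf => ?_, fun f hf => ?_⟩
    · rw [hL' f hf, hy, signedIntegral_withDensityᵥ (integrable_coeFn y) hf.continuous_comp]
      rfl
    · exact (fisherRao_withDensityᵥ_le (Lp.stronglyMeasurable y).measurable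
        (integrable_coeFn y) f).trans (hle f fun z => (hf z).le)

section SqMeasure

theorem integral_sqMeasure {α : Type*} [MeasureSpace α] {u : α → ℝ} (hu : AEMeasurable u)
    (f : α → ℝ) : ∫ z, f z ∂(sqMeasure u) = ∫ z, u z ^ 2 * f z := by
  rw [sqMeasure, integral_withDensity_eq_integral_toReal_smul₀ (by fun_prop) (by simp)]
  simp only [smul_eq_mul, ENNReal.toReal_ofReal (sq_nonneg _)]

theorem aemeasurable_coeFn {α : Type*} {_ : MeasurableSpace α} {μ : Measure α} (u : Lp ℝ 2 μ) :
    AEMeasurable u μ :=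
  (Lp.stronglyMeasurable u).measurable.aemeasurable

theorem integral_sqMeasure_eq_inner {X : Type*} [TopologicalSpace X] [CompactSpace X]
    [MeasureSpace X] [BorelSpace X] [IsFiniteMeasure (volume : Measure X)]
    (u : Lp ℝ 2 (volume : Measure X)) (f : C(X, ℝ)) :
    ∫ z, f z ∂(sqMeasure u) = inner ℝ (mulLp f u) u := by
  simp only [inner_mulLp, integral_sqMeasure (aemeasurable_coeFn u), sq]

instance isFiniteMeasure_sqMeasure {α : Type*} [MeasureSpace α]
    (u : Lp ℝ 2 (volume : Measure α)) : IsFiniteMeasure (sqMeasure u) :=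
  isFiniteMeasure_withDensity_ofReal (integrable_coeFn_sq u).2

variable {X : Type*} [TopologicalSpace X] [CompactSpace X] [MeasureSpace X]
  [OpensMeasurableSpace X]

/-- Integration against `2uv`, as a linear form on continuous functions. When `v = u̇`, it is the
time derivative of `u²`. -/
def mulForm (u v : Lp ℝ 2 (volume : Measure X)) : C(X, ℝ) →ₗ[ℝ] ℝ where
  toFun f := ∫ z, 2 * (u z * v z) * f z
  map_add' f g := by
    have huv := (integrable_coeFn_mul u v).const_mul 2
    simp only [ContinuousMap.add_apply, mul_add]
    exact integral_add (integrable_mul_of_continuous huv f.continuous)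
      (integrable_mul_of_continuous huv g.continuous)
  map_smul' c f := by
    simp only [ContinuousMap.smul_apply, smul_eq_mul, mul_left_comm _ c, integral_const_mul,
      RingHom.id_apply]

theorem isDominated_mulForm (u v : Lp ℝ 2 (volume : Measure X)) :
    IsDominated (mulForm u v) (sqMeasure u) (sqMeasure v) := by
  intro g h
  have hu : Integrable fun z => u z ^ 2 * g z ^ 2 :=
    integrable_mul_of_continuous (integrable_coeFn_sq u) (g.continuous.pow 2)
  have hv : Integrable fun z => v z ^ 2 * h z ^ 2 :=
    integrable_mul_of_continuous (integrable_coeFn_sq v) (h.continuous.pow 2)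
  rw [integral_sqMeasure (aemeasurable_coeFn u), integral_sqMeasure (aemeasurable_coeFn v),
    ← integral_add hu hv]
  refine integral_mono (integrable_mul_of_continuous ((integrable_coeFn_mul u v).const_mul 2)
    (g * h).continuous) (hu.add hv) fun z => ?_
  simp only [ContinuousMap.mul_apply]
  linarith [sq_nonneg (u z * g z - v z * h z)]

end SqMeasure

theorem IsWeakTimeDeriv.isTimeDerivForm_sqMeasure {u v : L2Square} (huv : IsWeakTimeDeriv u v) :
    IsTimeDerivForm (sqMeasure u) (mulForm u v) := by
  intro f hf
  rw [integral_sqMeasure (aemeasurable_coeFn u), integral_timeDeriv_mul_sq huv hf]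
  rfl

/-! ### Weak limits -/

section WeakLimits

variable {ι : Type*} {l : Filter ι}

section TendstoWeakly

variable {H H' : Type*} [NormedAddCommGroup H] [InnerProductSpace ℝ H] [NormedAddCommGroup H']
  [InnerProductSpace ℝ H'] {u v : ι → H} {u' v' : H}

/-- Weak convergence in a Hilbert space. -/
def TendstoWeakly (u : ι → H) (l : Filter ι) (u' : H) : Prop :=
  ∀ h, Tendsto (fun i => inner ℝ h (u i)) l (𝓝 (inner ℝ h u'))

namespace TendstoWeakly

theorem add (hu : TendstoWeakly u l u') (hv : TendstoWeakly v l v') :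
    TendstoWeakly (fun i => u i + v i) l (u' + v') := fun h => by
  simpa only [inner_add_right] using (hu h).add (hv h)

theorem map [CompleteSpace H] [CompleteSpace H'] (A : H →L[ℝ] H') (hu : TendstoWeakly u l u') :
    TendstoWeakly (fun i => A (u i)) l (A u') := fun h => by
  simpa only [ContinuousLinearMap.adjoint_inner_left] using hu (A.adjoint h)

theorem inner_of_tendsto {K : ℝ} (hu : TendstoWeakly u l u') (hK : ∀ᶠ i in l, ‖u i‖ ≤ K)
    (hv : Tendsto v l (𝓝 v')) : Tendsto (fun i => inner ℝ (v i) (u i)) l (𝓝 (inner ℝ v' u')) := by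
  have hzero : Tendsto (fun i => inner ℝ (v i - v') (u i)) l (𝓝 0) := by
    refine squeeze_zero_norm' (a := fun i => ‖v i - v'‖ * K) ?_ ?_
    · filter_upwards [hK] with i hi
      exact (norm_inner_le_norm _ _).trans (by gcongr)
    · simpa using (tendsto_iff_norm_sub_tendsto_zero.1 hv).mul_const K
  simpa only [inner_sub_left, sub_add_cancel, zero_add] using hzero.add (hu v')

end TendstoWeakly

end TendstoWeakly

section Measures

theorem integral_sub_measure {X : Type*} {_ : MeasurableSpace X} {κ μ : Measure X}
    [IsFiniteMeasure κ] (h : κ ≤ μ) {f : X → ℝ} (hf : Integrable f μ) :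
    ∫ z, f z ∂(μ - κ) = (∫ z, f z ∂μ) - ∫ z, f z ∂κ := by
  have hadd := integral_add_measure (hf.mono_measure (Measure.sub_le (ν := κ)))
    (hf.mono_measure h)
  rw [Measure.sub_add_cancel_of_le h] at hadd
  linarith

variable {X : Type*} [TopologicalSpace X] [MeasurableSpace X] {μ ν : ι → Measure X}
  {μ' ν' : Measure X}

/-- Convergence of the integrals of continuous functions. The measures are not bundled with their
finiteness, so that it applies to combinations of measures. -/
def MeasureTendsto (μ : ι → Measure X) (l : Filter ι) (μ' : Measure X) : Prop :=
  ∀ f : C(X, ℝ), Tendsto (fun i => ∫ z, f z ∂(μ i)) l (𝓝 (∫ z, f z ∂μ'))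

theorem MeasureTendsto.real_univ (h : MeasureTendsto μ l μ') :
    Tendsto (fun i => (μ i).real univ) l (𝓝 (μ'.real univ)) := by
  simpa using h 1

theorem measureTendsto_of_tendsto [CompactSpace X] [OpensMeasurableSpace X]
    {m : ι → FiniteMeasure X} {m' : FiniteMeasure X} (hm : Tendsto m l (𝓝 m')) :
    MeasureTendsto (fun i => (m i : Measure X)) l m' := fun f =>
  FiniteMeasure.tendsto_iff_forall_integral_tendsto.1 hm (BoundedContinuousFunction.mkOfCompact f)

theorem exists_tendsto_of_eventually_norm_le {E : Type*} [SeminormedAddCommGroup E]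
    [ProperSpace E] (U : Ultrafilter ι) {F : ι → E} {C : ℝ}
    (h : ∀ᶠ i in (U : Filter ι), ‖F i‖ ≤ C) : ∃ c, Tendsto F U (𝓝 c) := by
  obtain ⟨c, -, hc⟩ := (isCompact_closedBall (0 : E) C).ultrafilter_le_nhds (U.map F)
    (le_principal_iff.2 (h.mono fun i hi => mem_closedBall_zero_iff.2 hi))
  exact ⟨c, hc⟩

theorem IsDominated.abs_apply_le {L : C(X, ℝ) →ₗ[ℝ] ℝ} {μ ν : Measure X} (h : IsDominated L μ ν)
    (g : C(X, ℝ)) : |L g| ≤ (∫ z, g z ^ 2 ∂μ) + ν.real univ := by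
  have hpos := h g 1
  have hneg := h (-g) 1
  simp only [mul_one, ContinuousMap.one_apply, one_pow, integral_const, smul_eq_mul, map_neg,
    ContinuousMap.neg_apply, neg_sq] at hpos hneg
  exact abs_le.2 ⟨by linarith, hpos⟩

theorem IsDominated.exists_tendsto {U : Ultrafilter ι} {L : ι → C(X, ℝ) →ₗ[ℝ] ℝ}
    (hL : ∀ᶠ i in (U : Filter ι), IsDominated (L i) (μ i) (ν i)) (hμ : MeasureTendsto μ U μ')
    (hν : MeasureTendsto ν U ν') :
    ∃ L', IsDominated L' μ' ν' ∧ ∀ g, Tendsto (fun i => L i g) U (𝓝 (L' g)) := by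
  have hlim (g : C(X, ℝ)) : ∃ c, Tendsto (fun i => L i g) U (𝓝 c) := by
    refine exists_tendsto_of_eventually_norm_le U
      (C := (∫ z, (g ^ 2) z ∂μ') + ν'.real univ + 1) ?_
    filter_upwards [hL,
      ((hμ (g ^ 2)).add hν.real_univ).eventually_le_const (lt_add_one _)] with i hi hle
    exact (hi.abs_apply_le g).trans hle
  choose L' hL' using hlim
  refine ⟨linearMapOfTendsto L' L (tendsto_pi_nhds.2 hL'), fun g h => ?_, hL'⟩
  refine le_of_tendsto_of_tendsto (hL' (g * h)) ((hμ (g ^ 2)).add (hν (h ^ 2))) ?_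
  filter_upwards [hL] with i hi
  exact hi g h

theorem measure_le_of_integral_le [CompactSpace X] [BorelSpace X] [HasOuterApproxClosed X]
    {κ μ : Measure X} [IsFiniteMeasure κ] [IsFiniteMeasure μ] [κ.WeaklyRegular]
    (h : ∀ f : C(X, ℝ), (∀ z, 0 ≤ f z) → ∫ z, f z ∂κ ≤ ∫ z, f z ∂μ) : κ ≤ μ := by
  have lintegral_le (φ : BoundedContinuousFunction X NNReal) :
      ∫⁻ z, φ z ∂κ ≤ ∫⁻ z, φ z ∂μ := by
    let f : C(X, ℝ) := ⟨fun z => φ z, by fun_prop⟩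
    have integral_eq (m : Measure X) [IsFiniteMeasure m] :
        ∫⁻ z, φ z ∂m = ENNReal.ofReal (∫ z, f z ∂m) := by
      rw [ofReal_integral_eq_lintegral_ofReal (integrable_of_continuous f.continuous)
        (Eventually.of_forall fun z => (φ z).2)]
      exact lintegral_congr fun z => (ENNReal.ofReal_coe_nnreal).symm
    rw [integral_eq, integral_eq]
    exact ENNReal.ofReal_le_ofReal (h f fun z => (φ z).2)
  have le_of_isClosed (F : Set X) (hF : IsClosed F) : κ F ≤ μ F :=
    ge_of_tendsto' (HasOuterApproxClosed.tendsto_lintegral_apprSeq hF μ) fun n =>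
      (HasOuterApproxClosed.measure_le_lintegral hF κ n).trans (lintegral_le (hF.apprSeq n))
  refine Measure.le_iff.2 fun s hs => ?_
  rw [hs.measure_eq_iSup_isClosed_of_ne_top (measure_ne_top κ s)]
  exact iSup₂_le fun K hK => iSup_le fun hKc => (le_of_isClosed K hKc).trans (measure_mono hK)

end Measures

section Defect

variable {X : Type*} [TopologicalSpace X] [CompactSpace X] [MeasureSpace X] [BorelSpace X]
  [IsFiniteMeasure (volume : Measure X)] {u : ι → Lp ℝ 2 (volume : Measure X)}
  {u' : Lp ℝ 2 (volume : Measure X)} {μ : ι → Measure X} {μ' : Measure X}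
  [∀ i, IsFiniteMeasure (μ i)]

theorem integral_sub_sqMeasure_add_sqMeasure_sub {μ : Measure X} [IsFiniteMeasure μ]
    {u : Lp ℝ 2 (volume : Measure X)} (h : sqMeasure u ≤ μ) (u' : Lp ℝ 2 (volume : Measure X))
    (f : C(X, ℝ)) :
    ∫ z, f z ∂(μ - sqMeasure u + sqMeasure (u - u')) =
      (∫ z, f z ∂μ) - 2 * inner ℝ (mulLp f u') u + ∫ z, f z ∂(sqMeasure u') := by
  have hf (m : Measure X) [IsFiniteMeasure m] : Integrable f m :=
    integrable_of_continuous f.continuous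
  rw [integral_add_measure (hf _) (hf _), integral_sub_measure h (hf μ),
    integral_sqMeasure_eq_inner, integral_sqMeasure_eq_inner, integral_sqMeasure_eq_inner,
    map_sub, inner_sub_left, inner_sub_right, inner_sub_right, inner_mulLp_comm f u u']
  ring

theorem tendsto_integral_defect (hu : TendstoWeakly u l u') (hμ : MeasureTendsto μ l μ')
    (hle : ∀ᶠ i in l, sqMeasure (u i) ≤ μ i) (f : C(X, ℝ)) :
    Tendsto (fun i => ∫ z, f z ∂(μ i - sqMeasure (u i) + sqMeasure (u i - u'))) l
      (𝓝 ((∫ z, f z ∂μ') - ∫ z, f z ∂(sqMeasure u'))) := by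
  have hlim := ((hμ f).sub ((hu (mulLp f u')).const_mul 2)).add_const (∫ z, f z ∂(sqMeasure u'))
  have limit_eq : (∫ z, f z ∂μ') - 2 * inner ℝ (mulLp f u') u' + ∫ z, f z ∂(sqMeasure u') =
      (∫ z, f z ∂μ') - ∫ z, f z ∂(sqMeasure u') := by
    rw [integral_sqMeasure_eq_inner]
    ring
  rw [← limit_eq]
  refine hlim.congr' ?_
  filter_upwards [hle] with i hi
  rw [integral_sub_sqMeasure_add_sqMeasure_sub hi]

theorem sqMeasure_le_of_tendsto [HasOuterApproxClosed X] [IsFiniteMeasure μ'] [l.NeBot]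
    [(sqMeasure u').WeaklyRegular] (hu : TendstoWeakly u l u') (hμ : MeasureTendsto μ l μ')
    (hle : ∀ᶠ i in l, sqMeasure (u i) ≤ μ i) : sqMeasure u' ≤ μ' :=
  measure_le_of_integral_le fun f hf =>
    sub_nonneg.1 (ge_of_tendsto' (tendsto_integral_defect hu hμ hle f) fun _ => integral_nonneg hf)

/-- The square of the weakly vanishing part `uᵢ - u'` is not lost in the limit: it is added to the
defect `μᵢ - uᵢ²`. -/
theorem measureTendsto_defect [HasOuterApproxClosed X] [IsFiniteMeasure μ'] [l.NeBot]
    [(sqMeasure u').WeaklyRegular] (hu : TendstoWeakly u l u') (hμ : MeasureTendsto μ l μ')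
    (hle : ∀ᶠ i in l, sqMeasure (u i) ≤ μ i) :
    MeasureTendsto (fun i => μ i - sqMeasure (u i) + sqMeasure (u i - u')) l
      (μ' - sqMeasure u') := fun f => by
  rw [integral_sub_measure (sqMeasure_le_of_tendsto hu hμ hle)
    (integrable_of_continuous f.continuous)]
  exact tendsto_integral_defect hu hμ hle f

end Defect

section Relaxation

theorem H1.isWeakTimeDeriv (p : H1) : IsWeakTimeDeriv (H1.fn p) (H1.dot p) := p.2

theorem IsWeakTimeDeriv.sub {u v u' v' : L2Square} (h : IsWeakTimeDeriv u v)
    (h' : IsWeakTimeDeriv u' v') : IsWeakTimeDeriv (u - u') (v - v') := by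
  simpa only [neg_smul, one_smul, ← sub_eq_add_neg] using h.add (h'.smul (-1))

theorem IsTimeDerivForm.add {μ μ' : Measure Square} [IsFiniteMeasure μ] [IsFiniteMeasure μ']
    {L L' : C(Square, ℝ) →ₗ[ℝ] ℝ} (h : IsTimeDerivForm μ L) (h' : IsTimeDerivForm μ' L') :
    IsTimeDerivForm (μ + μ') (L + L') := fun f hf => by
  rw [integral_add_measure (integrable_of_continuous hf.continuous_timeDeriv)
    (integrable_of_continuous hf.continuous_timeDeriv), h f hf, h' f hf, LinearMap.add_apply,
    neg_add]

theorem isTimeDerivForm_of_tendsto [l.NeBot] {μ : ι → Measure Square} {μ' : Measure Square}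
    {L : ι → C(Square, ℝ) →ₗ[ℝ] ℝ} {L' : C(Square, ℝ) →ₗ[ℝ] ℝ} (hμ : MeasureTendsto μ l μ')
    (hL : ∀ g, Tendsto (fun i => L i g) l (𝓝 (L' g)))
    (h : ∀ᶠ i in l, IsTimeDerivForm (μ i) (L i)) : IsTimeDerivForm μ' L' := fun f hf =>
  tendsto_nhds_unique_of_eventuallyEq (hμ ⟨timeDeriv f, hf.continuous_timeDeriv⟩)
    (hL hf.restrict).neg (h.mono fun _ hi => hi f hf)

theorem isRelaxation_of_tendsto {U : Ultrafilter ι} {p : ι → H1} {p' : H1}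
    {μ ν : ι → Measure Square} {μ' ν' : Measure Square} [∀ i, IsFiniteMeasure (μ i)]
    [∀ i, IsFiniteMeasure (ν i)] [IsFiniteMeasure μ'] [IsFiniteMeasure ν']
    (hp : TendstoWeakly (fun i => H1.fn (p i)) U (H1.fn p'))
    (hdot : TendstoWeakly (fun i => H1.dot (p i)) U (H1.dot p'))
    (hμ : MeasureTendsto μ U μ') (hν : MeasureTendsto ν U ν')
    (h : ∀ᶠ i in (U : Filter ι), IsRelaxation (p i) (μ i) (ν i)) : IsRelaxation p' μ' ν' := by
  have sq_le := h.mono fun i hi => hi.sq_le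
  have sq_dot_le := h.mono fun i hi => hi.sq_dot_le
  refine ⟨sqMeasure_le_of_tendsto hp hμ sq_le, sqMeasure_le_of_tendsto hdot hν sq_dot_le, ?_⟩
  obtain ⟨L, hL⟩ :=
    (h.mono fun i hi => fisherRaoLE_iff_exists_isDominated.1 hi.fisherRao_le).choice
  have hdefect := measureTendsto_defect hp hμ sq_le
  obtain ⟨L', hL', hlim⟩ := IsDominated.exists_tendsto
    (hL.mono fun i hi =>
      hi.1.add (isDominated_mulForm (H1.fn (p i) - H1.fn p') (H1.dot (p i) - H1.dot p')))
    hdefect (measureTendsto_defect hdot hν sq_dot_le)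
  refine fisherRaoLE_iff_exists_isDominated.2
    ⟨L', hL', isTimeDerivForm_of_tendsto hdefect hlim (hL.mono fun i hi => ?_)⟩
  exact hi.2.add ((H1.isWeakTimeDeriv _).sub (H1.isWeakTimeDeriv _)).isTimeDerivForm_sqMeasure

theorem IsRelaxation.exists_isDominated {p : H1} {μ ν : Measure Square} [IsFiniteMeasure μ]
    [IsFiniteMeasure ν] (h : IsRelaxation p μ ν) :
    ∃ L, IsDominated L μ ν ∧ IsTimeDerivForm μ L := by
  obtain ⟨L, hL, hL'⟩ := fisherRaoLE_iff_exists_isDominated.1 h.fisherRao_le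
  have hadd := hL.add (isDominated_mulForm (H1.fn p) (H1.dot p))
  have hadd' := hL'.add (H1.isWeakTimeDeriv p).isTimeDerivForm_sqMeasure
  rw [Measure.sub_add_cancel_of_le h.sq_le] at hadd hadd'
  rw [Measure.sub_add_cancel_of_le h.sq_dot_le] at hadd
  exact ⟨_, hadd, hadd'⟩

end Relaxation

end WeakLimits

theorem tendstoUniformly_of_eventually_equicontinuous {ι Y E : Type*} [PseudoMetricSpace Y]
    [CompactSpace Y] [PseudoMetricSpace E] {l : Filter ι} [l.NeBot] {F : ι → Y → E} {F' : Y → E}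
    (hF : ∀ ε > 0, ∃ δ > 0, ∀ᶠ i in l, ∀ y y', dist y y' < δ → dist (F i y) (F i y') ≤ ε)
    (hlim : ∀ y, Tendsto (fun i => F i y) l (𝓝 (F' y))) : TendstoUniformly F F' l := by
  refine Metric.tendstoUniformly_iff.2 fun ε hε => ?_
  obtain ⟨δ, hδ, hequi⟩ := hF (ε / 4) (by positivity)
  have limit_equi (y y' : Y) (hy : dist y y' < δ) : dist (F' y) (F' y') ≤ ε / 4 :=
    le_of_tendsto ((hlim y).dist (hlim y')) (hequi.mono fun i hi => hi y y' hy)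
  obtain ⟨t, -, ht, hcover⟩ := finite_cover_balls_of_compact (isCompact_univ (X := Y)) hδ
  have hnet : ∀ᶠ i in l, ∀ c ∈ t, dist (F i c) (F' c) < ε / 4 := by
    rw [ht.eventually_all]
    exact fun c _ => Metric.tendsto_nhds.1 (hlim c) _ (by positivity)
  filter_upwards [hequi, hnet] with i hequi hnet y
  obtain ⟨c, hc, hyc⟩ := mem_iUnion₂.1 (hcover (mem_univ y))
  calc dist (F' y) (F i y)
      ≤ dist (F' y) (F' c) + dist (F' c) (F i c) + dist (F i c) (F i y) := dist_triangle4 _ _ _ _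
    _ < ε := by
      rw [dist_comm (F' c), dist_comm (F i c) (F i y)]
      linarith [limit_equi y c hyc, hnet c hc, hequi y c hyc]

/-! ### Hölder regularity of disintegrations -/

theorem continuous_integral_continuousMap {X : Type*} [TopologicalSpace X] [CompactSpace X]
    [MeasurableSpace X] [BorelSpace X] (m : Measure X) [IsFiniteMeasure m] :
    Continuous fun f : C(X, ℝ) => ∫ z, f z ∂m := by
  refine (continuous_integral.comp (ContinuousMap.toLp 1 m ℝ).continuous).congr fun f => ?_
  exact integral_congr_ae (ContinuousMap.coeFn_toLp m f)

theorem IsDominated.sq_integral_deriv_mul_le {L : C(Square, ℝ) →ₗ[ℝ] ℝ} {μ ν : Measure Square}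
    [IsFiniteMeasure μ] [IsFiniteMeasure ν] (hd : IsDominated L μ ν) (hL : IsTimeDerivForm μ L)
    {θ : ℝ → ℝ} (hθ : IsTest θ) (h : C(I, ℝ)) :
    (∫ z, deriv θ z.1 * h z.2 ∂μ) ^ 2 ≤ 4 * (∫ z, θ z.1 ^ 2 ∂μ) * ∫ z, h z.2 ^ 2 ∂ν := by
  have continuous_snd' : Continuous fun h : C(I, ℝ) => h.comp (ContinuousMap.snd : C(Square, I)) :=
    ContinuousMap.continuous_precomp _
  let θ' : C(Square, ℝ) := ⟨fun z => deriv θ z.1, hθ.continuous_deriv_coe.comp continuous_fst⟩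
  have continuous_left : Continuous fun h : C(I, ℝ) => ∫ z, deriv θ z.1 * h z.2 ∂μ :=
    (continuous_integral_continuousMap μ).comp (continuous_snd'.const_mul θ')
  have continuous_right : Continuous fun h : C(I, ℝ) => ∫ z, h z.2 ^ 2 ∂ν :=
    (continuous_integral_continuousMap ν).comp (continuous_snd'.pow 2)
  refine mem_of_isClosed_of_contDiff (A := {h | (∫ z, deriv θ z.1 * h z.2 ∂μ) ^ 2 ≤
    4 * (∫ z, θ z.1 ^ 2 ∂μ) * ∫ z, h z.2 ^ 2 ∂ν})
    (isClosed_le (continuous_left.pow 2) (continuous_right.const_mul _)) (fun φ hφ hφ' => ?_) h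
  have hform := hL _ (hθ.isTimeTest_mul hφ hφ')
  simp only [timeDeriv_mul hθ hφ] at hform
  have hsq := hd.sq_le ⟨fun z => θ z.1, hθ.continuous_coe.comp continuous_fst⟩
    ⟨fun z => φ z.2, by fun_prop⟩
  rw [← neg_sq] at hsq
  exact (congrArg (· ^ 2) hform).trans_le hsq

/-- A smooth monotone transition from `0` to `1` on `[c - δ, c]`. -/
def step (c δ τ : ℝ) : ℝ := Real.smoothTransition ((τ - c) / δ + 1)

section step

variable {c c' δ τ ε y : ℝ} {F : I → ℝ}

theorem contDiff_step (c δ : ℝ) : ContDiff ℝ ∞ (step c δ) :=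
  Real.smoothTransition.contDiff.comp (by fun_prop)

theorem continuous_deriv_step (c δ : ℝ) : Continuous (deriv (step c δ)) :=
  (contDiff_step c δ).continuous_deriv (by simp)

theorem differentiable_step (c δ : ℝ) : Differentiable ℝ (step c δ) :=
  (contDiff_step c δ).differentiable (by simp)

theorem step_eq_zero (hδ : 0 < δ) (h : τ ≤ c - δ) : step c δ τ = 0 := by
  apply Real.smoothTransition.zero_of_nonpos
  have : (τ - c) / δ ≤ -1 := by rw [div_le_iff₀ hδ]; linarith
  linarith

theorem step_eq_one (hδ : 0 < δ) (h : c ≤ τ) : step c δ τ = 1 := by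
  apply Real.smoothTransition.one_of_one_le
  have : 0 ≤ (τ - c) / δ := div_nonneg (by linarith) hδ.le
  linarith

theorem monotone_step (c : ℝ) (hδ : 0 < δ) : Monotone (step c δ) := fun _ _ _ =>
  Real.smoothTransition.monotone (by gcongr)

theorem step_le_step (hδ : 0 < δ) (h : c ≤ c') (τ : ℝ) : step c' δ τ ≤ step c δ τ :=
  Real.smoothTransition.monotone (by gcongr)

theorem deriv_step_eq_zero (hδ : 0 < δ) (hτ : τ ∉ Icc (c - δ) c) : deriv (step c δ) τ = 0 := by
  rcases not_and_or.1 hτ with h | h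
  · refine ((hasDerivAt_const τ (0 : ℝ)).congr_of_eventuallyEq ?_).deriv
    filter_upwards [Iio_mem_nhds (not_le.1 h)] with x hx using step_eq_zero hδ hx.le
  · refine ((hasDerivAt_const τ (1 : ℝ)).congr_of_eventuallyEq ?_).deriv
    filter_upwards [Ioi_mem_nhds (not_le.1 h)] with x hx using step_eq_one hδ hx.le

theorem integral_deriv_step (hδ : 0 < δ) (hδc : δ ≤ c) (hc : c ≤ 1) :
    ∫ τ : I, deriv (step c δ) τ = 1 := by
  rw [integral_unitInterval, intervalIntegral.integral_deriv_eq_sub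
    (fun x _ => differentiable_step c δ x) ((continuous_deriv_step c δ).intervalIntegrable _ _),
    step_eq_one hδ hc, step_eq_zero hδ (sub_nonneg.2 hδc), sub_zero]

theorem abs_integral_deriv_step_mul_sub_le (hδ : 0 < δ) (hδc : δ ≤ c) (hc : c ≤ 1)
    (hF : Continuous F) (h : ∀ x : I, (x : ℝ) ∈ Icc (c - δ) c → |F x - y| ≤ ε) :
    |(∫ τ : I, deriv (step c δ) τ * F τ) - y| ≤ ε := by
  have hcont : Continuous fun τ : I => deriv (step c δ) τ :=
    (continuous_deriv_step c δ).comp continuous_subtype_val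
  have sub_eq : (∫ τ : I, deriv (step c δ) τ * F τ) - y =
      ∫ τ : I, deriv (step c δ) τ * (F τ - y) := by
    simp only [mul_sub]
    rw [integral_sub (integrable_of_continuous (hcont.fun_mul hF))
      (integrable_of_continuous (hcont.mul_const y)), integral_mul_const,
      integral_deriv_step hδ hδc hc, one_mul]
  rw [sub_eq, ← Real.norm_eq_abs]
  calc ‖∫ τ : I, deriv (step c δ) τ * (F τ - y)‖ ≤ ∫ τ : I, deriv (step c δ) τ * ε := by
        refine norm_integral_le_of_norm_le (integrable_of_continuous (hcont.mul_const ε))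
          (Eventually.of_forall fun τ => ?_)
        by_cases hτ : (τ : ℝ) ∈ Icc (c - δ) c
        · have hnonneg : 0 ≤ deriv (step c δ) τ := (monotone_step c hδ).deriv_nonneg
          rw [norm_mul, Real.norm_of_nonneg hnonneg]
          exact mul_le_mul_of_nonneg_left (h τ hτ) hnonneg
        · simp [deriv_step_eq_zero hδ hτ]
    _ = ε := by rw [integral_mul_const, integral_deriv_step hδ hδc hc, one_mul]

end step

theorem exists_isTest_abs_integral_deriv_mul_sub_le {s t : I} (hs : 0 < s) (hst : s < t)
    (ht : t < 1) {F : I → ℝ} (hF : Continuous F) {ε : ℝ} (hε : 0 < ε) :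
    ∃ θ, IsTest θ ∧ (∀ τ, θ τ ∈ Icc (0 : ℝ) 1) ∧ (∀ τ ∉ Icc (s : ℝ) t, θ τ = 0) ∧
      |(∫ τ : I, deriv θ τ * F τ) - (F s - F t)| ≤ ε := by
  have hs' : (0 : ℝ) < s := hs
  have hst' : (s : ℝ) < t := hst
  have ht' : (t : ℝ) < 1 := ht
  obtain ⟨δ₀, hδ₀, hmod⟩ := Metric.uniformContinuous_iff.1
    (CompactSpace.uniformContinuous_of_continuous hF) (ε / 2) (by positivity)
  obtain ⟨δ, hδ, hδlt⟩ : ∃ δ : ℝ, 0 < δ ∧ δ < min δ₀ (t - s) :=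
    exists_between (lt_min hδ₀ (sub_pos.2 hst'))
  obtain ⟨hδδ₀, hδts⟩ := lt_min_iff.1 hδlt
  have hsupp (τ : ℝ) (hτ : τ ∉ Icc (s : ℝ) t) : step (s + δ) δ τ - step t δ τ = 0 := by
    rcases not_and_or.1 hτ with h | h <;> rw [not_le] at h
    · rw [step_eq_zero hδ (by linarith), step_eq_zero hδ (by linarith), sub_zero]
    · rw [step_eq_one hδ (by linarith), step_eq_one hδ h.le, sub_self]
  have hclose {x r : I} (h : |(x : ℝ) - r| ≤ δ) : |F x - F r| ≤ ε / 2 :=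
    (hmod (show dist x r < δ₀ from h.trans_lt hδδ₀)).le
  have near_s := abs_integral_deriv_step_mul_sub_le hδ (c := s + δ) (by linarith) (by linarith) hF
    fun x hx => hclose (r := s) (abs_le.2 ⟨by linarith [hx.1], by linarith [hx.2]⟩)
  have near_t := abs_integral_deriv_step_mul_sub_le hδ (c := t) (by linarith) ht'.le hF
    fun x hx => hclose (r := t) (abs_le.2 ⟨by linarith [hx.1], by linarith [hx.2]⟩)
  refine ⟨fun τ => step (s + δ) δ τ - step t δ τ,
    IsTest.of_Icc ((contDiff_step _ _).sub (contDiff_step _ _)) hs' ht' hsupp, fun τ => ⟨?_, ?_⟩,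
    hsupp, ?_⟩
  · exact sub_nonneg.2 (step_le_step hδ (by linarith) τ)
  · exact (sub_le_self _ (Real.smoothTransition.nonneg _)).trans (Real.smoothTransition.le_one _)
  · have hint (c : ℝ) : Integrable fun τ : I => deriv (step c δ) τ * F τ :=
      integrable_of_continuous (((continuous_deriv_step c δ).comp continuous_subtype_val).mul hF)
    simp only [deriv_fun_sub (differentiable_step _ _ _) (differentiable_step _ _ _), sub_mul]
    rw [integral_sub (hint _) (hint _), sub_sub_sub_comm]
    exact (abs_sub _ _).trans (by linarith)

theorem continuous_integral_path {X Y : Type*} [TopologicalSpace X] [CompactSpace X]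
    [MeasurableSpace X] [OpensMeasurableSpace X] [TopologicalSpace Y] {m : Y → FiniteMeasure X}
    (hm : Continuous m) (h : C(X, ℝ)) : Continuous fun t => ∫ x, h x ∂(m t : Measure X) :=
  continuous_iff_continuousAt.2 fun t =>
    FiniteMeasure.tendsto_iff_forall_integral_tendsto.1 (hm.tendsto t)
      (BoundedContinuousFunction.mkOfCompact h)

theorem IsDisintegration.integral_mul {μ : Measure Square} {m : I → FiniteMeasure I}
    (hm : IsDisintegration μ m) {g : I → ℝ} (hg : Continuous g) (h : C(I, ℝ)) :
    ∫ z, g z.1 * h z.2 ∂μ = ∫ t : I, g t * ∫ x, h x ∂(m t : Measure I) := by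
  refine (hm.2 ⟨fun z => g z.1 * h z.2, by fun_prop⟩).trans ?_
  simp only [ContinuousMap.coe_mk, integral_const_mul]

theorem dense_Ioo_unitInterval : Dense (Ioo (0 : I) 1) := by
  rw [dense_iff_closure_eq, closure_Ioo zero_ne_one, ← unitInterval.univ_eq_Icc]

theorem rel_of_isClosed_of_Ioo {R : I → I → Prop} (hR : IsClosed {p : I × I | R p.1 p.2})
    (hsymm : ∀ s t, R s t → R t s) (h : ∀ s t, 0 < s → s ≤ t → t < 1 → R s t) (s t : I) :
    R s t := by
  refine (hR.closure_subset_iff.2 ?_) (dense_Ioo_unitInterval.prod dense_Ioo_unitInterval (s, t))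
  rintro ⟨s, t⟩ ⟨hs, ht⟩
  rcases le_total s t with hst | hst
  · exact h s t hs.1 hst ht.2
  · exact hsymm t s (h t s ht.1 hst hs.2)

section regularity

variable {L : C(Square, ℝ) →ₗ[ℝ] ℝ} {μ ν : Measure Square} [IsFiniteMeasure μ]
  [IsFiniteMeasure ν] {m : I → FiniteMeasure I}

theorem integral_fst_sq_le {θ : ℝ → ℝ} (hθ : ∀ τ, θ τ ∈ Icc (0 : ℝ) 1) {s t : I}
    (hsupp : ∀ τ ∉ Icc (s : ℝ) t, θ τ = 0) :
    ∫ z : Square, θ z.1 ^ 2 ∂μ ≤ μ.real (Prod.fst ⁻¹' Icc s t) := by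
  have hmeas : MeasurableSet (Prod.fst ⁻¹' Icc s t : Set Square) := measurable_fst measurableSet_Icc
  rw [← integral_indicator_one hmeas]
  refine integral_mono_of_nonneg (Eventually.of_forall fun _ => sq_nonneg _)
    ((integrable_const 1).indicator hmeas) (Eventually.of_forall fun z => ?_)
  by_cases hz : z.1 ∈ Icc s t
  · simpa [indicator_of_mem (show z ∈ Prod.fst ⁻¹' Icc s t from hz)] using
      pow_le_one₀ (n := 2) (hθ z.1).1 (hθ z.1).2
  · simp [indicator_of_notMem (show z ∉ Prod.fst ⁻¹' Icc s t from hz), hsupp z.1 hz]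

theorem IsDisintegration.sq_integral_sub_le (hm : IsDisintegration μ m) (hd : IsDominated L μ ν)
    (hL : IsTimeDerivForm μ L) {s t : I} (hs : 0 < s) (hst : s ≤ t) (ht : t < 1) (h : C(I, ℝ)) :
    ((∫ x, h x ∂(m s : Measure I)) - ∫ x, h x ∂(m t : Measure I)) ^ 2 ≤
      4 * μ.real (Prod.fst ⁻¹' Icc s t) * ∫ z, h z.2 ^ 2 ∂ν := by
  rcases hst.eq_or_lt with rfl | hst
  · simpa using by positivity
  rw [← sq_abs, ← Real.le_sqrt (abs_nonneg _) (by positivity)]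
  refine le_of_forall_pos_le_add fun ε hε => ?_
  obtain ⟨θ, hθ, hθ01, hsupp, happrox⟩ := exists_isTest_abs_integral_deriv_mul_sub_le hs hst ht
    (continuous_integral_path hm.1 h) hε
  have hsq := hd.sq_integral_deriv_mul_le hL hθ h
  rw [hm.integral_mul hθ.continuous_deriv_coe] at hsq
  have hbound : |∫ τ : I, deriv θ τ * ∫ x, h x ∂(m τ : Measure I)| ≤
      √(4 * μ.real (Prod.fst ⁻¹' Icc s t) * ∫ z, h z.2 ^ 2 ∂ν) :=
    Real.abs_le_sqrt (hsq.trans (by gcongr; exact integral_fst_sq_le hθ01 hsupp))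
  rw [abs_sub_comm] at happrox
  linarith [(abs_sub_abs_le_abs_sub _ _).trans happrox]

theorem IsDisintegration.real_univ_le (hm : IsDisintegration μ m) (hd : IsDominated L μ ν)
    (hL : IsTimeDerivForm μ L) (t : I) :
    (m t : Measure I).real univ ≤ 2 * μ.real univ + ν.real univ := by
  let M (t : I) : ℝ := (m t : Measure I).real univ
  have hcont : Continuous M := by simpa [M] using continuous_integral_path hm.1 1
  have hsq (s : I) : (M s - M t) ^ 2 ≤ 4 * μ.real univ * ν.real univ := by
    refine rel_of_isClosed_of_Ioo (R := fun s t => (M s - M t) ^ 2 ≤ 4 * μ.real univ * ν.real univ)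
      (isClosed_le (by fun_prop) (by fun_prop)) (fun s t h => by rwa [sub_sq_comm])
      (fun s t hs hst ht => ?_) s t
    refine le_trans (by simpa [M] using hm.sq_integral_sub_le hd hL hs hst ht 1) ?_
    gcongr 4 * ?_ * _
    exact measureReal_mono (subset_univ _)
  have hle (s : I) : M t - (μ.real univ + ν.real univ) ≤ M s := by
    have habs : |M s - M t| ≤ μ.real univ + ν.real univ :=
      abs_le_of_sq_le_sq (by nlinarith [hsq s, sq_nonneg (μ.real univ - ν.real univ)])
        (by positivity)
    linarith [(abs_le.1 habs).1]
  have hint : ∫ s, M s = μ.real univ := by simpa [M] using (hm.2 1).symm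
  have hmono := integral_mono (μ := volume) (integrable_const _)
    (integrable_of_continuous hcont) hle
  simp only [hint, integral_const, probReal_univ, one_smul] at hmono
  change M t ≤ _
  linarith

theorem IsDisintegration.map_fst_le (hm : IsDisintegration μ m) {K : NNReal}
    (hK : ∀ t, (m t).mass ≤ K) : μ.map Prod.fst ≤ K • volume := by
  refine measure_le_of_integral_le fun f hf => ?_
  rw [integral_map measurable_fst.aemeasurable f.continuous.aestronglyMeasurable,
    integral_smul_nnreal_measure, NNReal.smul_def, smul_eq_mul, ← integral_const_mul]
  have hfst := hm.integral_mul f.continuous 1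
  simp only [ContinuousMap.one_apply, mul_one, integral_const, smul_eq_mul] at hfst
  rw [hfst]
  refine integral_mono (integrable_of_continuous ?_) (integrable_of_continuous ?_) fun t => ?_
  · simpa using f.continuous.fun_mul (continuous_integral_path hm.1 1)
  · fun_prop
  · rw [mul_comm]
    exact mul_le_mul_of_nonneg_right (NNReal.coe_le_coe.2 (hK t)) (hf t)

theorem IsDisintegration.sq_integral_sub_le_mul_dist (hm : IsDisintegration μ m)
    (hd : IsDominated L μ ν) (hL : IsTimeDerivForm μ L) (h : C(I, ℝ)) (s t : I) :
    ((∫ x, h x ∂(m s : Measure I)) - ∫ x, h x ∂(m t : Measure I)) ^ 2 ≤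
      4 * (2 * μ.real univ + ν.real univ) * (∫ z, h z.2 ^ 2 ∂ν) * dist s t := by
  have hcont := continuous_integral_path hm.1 h
  refine rel_of_isClosed_of_Ioo (R := fun s t =>
    ((∫ x, h x ∂(m s : Measure I)) - ∫ x, h x ∂(m t : Measure I)) ^ 2 ≤
      4 * (2 * μ.real univ + ν.real univ) * (∫ z, h z.2 ^ 2 ∂ν) * dist s t)
    (isClosed_le (((hcont.comp continuous_fst).sub (hcont.comp continuous_snd)).pow 2)
      (by fun_prop)) (fun s t h => by rwa [sub_sq_comm, dist_comm])
    (fun s t hs hst ht => (hm.sq_integral_sub_le hd hL hs hst ht h).trans ?_) s t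
  have hmeasure : μ.real (Prod.fst ⁻¹' Icc s t) ≤ (2 * μ.real univ + ν.real univ) * dist s t := by
    lift 2 * μ.real univ + ν.real univ to NNReal using by positivity with K hK
    have hle := hm.map_fst_le (K := K)
      (fun t => NNReal.coe_le_coe.1 ((hm.real_univ_le hd hL t).trans_eq hK.symm)) (Icc s t)
    rw [Measure.map_apply measurable_fst measurableSet_Icc, Measure.smul_apply,
      unitInterval.volume_Icc] at hle
    refine (ENNReal.toReal_mono (ENNReal.mul_ne_top (by simp) (by simp)) hle).trans_eq ?_
    have hsub : (0 : ℝ) ≤ t - s := sub_nonneg.2 hst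
    rw [ENNReal.toReal_mul, ENNReal.toReal_ofReal hsub, ENNReal.coe_toReal, dist_comm,
      Subtype.dist_eq, Real.dist_eq, abs_of_nonneg hsub]
  calc 4 * μ.real (Prod.fst ⁻¹' Icc s t) * ∫ z, h z.2 ^ 2 ∂ν
      ≤ 4 * ((2 * μ.real univ + ν.real univ) * dist s t) * ∫ z, h z.2 ^ 2 ∂ν := by gcongr
    _ = _ := by ring

end regularity

section IsHolderPath

variable {X Y : Type*} [TopologicalSpace X] [CompactSpace X] [MeasurableSpace X]
  [OpensMeasurableSpace X] [PseudoMetricSpace Y] {C : ℝ}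

/-- A path of measures of mass at most `C` which is `1/2`-Hölder continuous, with constant `C`, for
the norm dual to that of the continuous functions. -/
structure IsHolderPath (C : ℝ) (m : Y → FiniteMeasure X) : Prop where
  mass_le : ∀ t, (m t : Measure X).real univ ≤ C
  dist_integral_le : ∀ (h : C(X, ℝ)) (s t : Y),
    dist (∫ x, h x ∂(m s : Measure X)) (∫ x, h x ∂(m t : Measure X)) ≤ C * ‖h‖ * √(dist s t)

namespace IsHolderPath

theorem continuous {m : Y → FiniteMeasure X} (hm : IsHolderPath C m) : Continuous m := by
  refine continuous_iff_continuousAt.2 fun t => ?_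
  refine FiniteMeasure.tendsto_iff_forall_integral_tendsto.2 fun f => ?_
  have hbound : Tendsto (fun s => C * ‖f.toContinuousMap‖ * √(dist s t)) (𝓝 t) (𝓝 0) :=
    Continuous.tendsto' (by fun_prop) t 0 (by simp)
  exact tendsto_iff_dist_tendsto_zero.2 (squeeze_zero (fun _ => dist_nonneg)
    (fun s => hm.dist_integral_le f.toContinuousMap s t) hbound)

theorem dist_integral_slice_le [CompactSpace Y] {m : Y → FiniteMeasure X} (hm : IsHolderPath C m)
    (f : C(Y × X, ℝ)) (s t : Y) :
    dist (∫ x, f (s, x) ∂(m s : Measure X)) (∫ x, f (t, x) ∂(m t : Measure X)) ≤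
      C * dist (f.curry s) (f.curry t) + C * ‖f‖ * √(dist s t) := by
  have hslice : dist (∫ x, f (s, x) ∂(m s : Measure X)) (∫ x, f (t, x) ∂(m s : Measure X)) ≤
      C * dist (f.curry s) (f.curry t) := by
    rw [Real.dist_eq, ← integral_sub (integrable_of_continuous (by fun_prop))
      (integrable_of_continuous (by fun_prop)), ← Real.norm_eq_abs, mul_comm]
    refine (norm_integral_le_of_norm_le_const (C := dist (f.curry s) (f.curry t))
      (Eventually.of_forall fun x => ?_)).trans (by gcongr; exact hm.mass_le s)
    exact ContinuousMap.dist_apply_le_dist (f := f.curry s) (g := f.curry t) x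
  have hcurry : ‖f.curry t‖ ≤ ‖f‖ :=
    (ContinuousMap.norm_le _ (norm_nonneg _)).2 fun x => f.norm_coe_le_norm (t, x)
  have hC : 0 ≤ C := measureReal_nonneg.trans (hm.mass_le t)
  refine (dist_triangle _ _ _).trans (add_le_add hslice ?_)
  exact (hm.dist_integral_le (f.curry t) s t).trans (by gcongr)

theorem exists_pos_forall_dist_integral_slice_le [CompactSpace Y] (C : ℝ) (f : C(Y × X, ℝ))
    {ε : ℝ} (hε : 0 < ε) :
    ∃ δ > 0, ∀ m : Y → FiniteMeasure X, IsHolderPath C m → ∀ s t, dist s t < δ →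
      dist (∫ x, f (s, x) ∂(m s : Measure X)) (∫ x, f (t, x) ∂(m t : Measure X)) ≤ ε := by
  have hcurry := tendsto_uniformity_iff_dist_tendsto_zero.1
    (CompactSpace.uniformContinuous_of_continuous f.curry.continuous)
  have hdist := tendsto_uniformity_iff_dist_tendsto_zero.1 (tendsto_id (x := uniformity Y))
  have hlim := (hcurry.const_mul C).add
    (((Real.continuous_sqrt.tendsto 0).comp hdist).const_mul (C * ‖f‖))
  simp only [Real.sqrt_zero, mul_zero, add_zero] at hlim
  obtain ⟨δ, hδ, h⟩ := Metric.mem_uniformity_dist.1 (hlim.eventually_le_const hε)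
  exact ⟨δ, hδ, fun m hm s t hst => (hm.dist_integral_slice_le f s t).trans (h hst)⟩

theorem continuous_integral_slice [CompactSpace Y] {m : Y → FiniteMeasure X}
    (hm : IsHolderPath C m) (f : C(Y × X, ℝ)) :
    Continuous fun t => ∫ x, f (t, x) ∂(m t : Measure X) :=
  Metric.continuous_iff.2 fun t ε hε => by
    obtain ⟨δ, hδ, h⟩ := exists_pos_forall_dist_integral_slice_le C f (half_pos hε)
    exact ⟨δ, hδ, fun s hs => (h m hm s t hs).trans_lt (half_lt_self hε)⟩

theorem of_tendsto {ι : Type*} {l : Filter ι} [l.NeBot] {m : ι → Y → FiniteMeasure X}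
    {m' : Y → FiniteMeasure X} (hm : ∀ᶠ i in l, IsHolderPath C (m i))
    (hlim : ∀ t, Tendsto (fun i => m i t) l (𝓝 (m' t))) : IsHolderPath C m' := by
  refine ⟨fun t => ?_, fun h s t => ?_⟩
  · exact le_of_tendsto (NNReal.tendsto_coe.2 ((FiniteMeasure.continuous_mass.tendsto _).comp
      (hlim t))) (hm.mono fun i hi => hi.mass_le t)
  · exact le_of_tendsto ((measureTendsto_of_tendsto (hlim s) h).dist
      (measureTendsto_of_tendsto (hlim t) h)) (hm.mono fun i hi => hi.dist_integral_le h s t)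

theorem exists_tendsto [BorelSpace X] [T2Space X] {ι : Type*} {U : Ultrafilter ι}
    {m : ι → Y → FiniteMeasure X} (hm : ∀ᶠ i in (U : Filter ι), IsHolderPath C (m i)) :
    ∃ m' : Y → FiniteMeasure X, IsHolderPath C m' ∧ ∀ t, Tendsto (fun i => m i t) U (𝓝 (m' t)) := by
  have hlim (t : Y) : ∃ n : FiniteMeasure X, Tendsto (fun i => m i t) U (𝓝 n) := by
    obtain ⟨n, -, hn⟩ := (isCompact_setOfPred_finiteMeasure_le_of_compactSpace X
      C.toNNReal).ultrafilter_le_nhds (U.map fun i => m i t) (le_principal_iff.2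
        (hm.mono fun i hi => NNReal.le_toNNReal_of_coe_le (hi.mass_le t)))
    exact ⟨n, hn⟩
  choose m' hm' using hlim
  exact ⟨m', of_tendsto hm hm', hm'⟩

end IsHolderPath

end IsHolderPath

theorem isDisintegration_of_tendsto {ι : Type*} {l : Filter ι} [l.NeBot] {μ : ι → Measure Square}
    {μ' : Measure Square} {m : ι → I → FiniteMeasure I} {m' : I → FiniteMeasure I} {C : ℝ}
    (hμ : MeasureTendsto μ l μ') (hm : ∀ᶠ i in l, IsDisintegration (μ i) (m i))
    (hC : ∀ᶠ i in l, IsHolderPath C (m i))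
    (hlim : ∀ t, Tendsto (fun i => m i t) l (𝓝 (m' t))) : IsDisintegration μ' m' := by
  have hm' := IsHolderPath.of_tendsto hC hlim
  refine ⟨hm'.continuous, fun f =>
    tendsto_nhds_unique (hμ f) (Metric.tendsto_nhds.2 fun ε hε => ?_)⟩
  have hunif : TendstoUniformly (fun i t => ∫ x, f (t, x) ∂(m i t : Measure I))
      (fun t => ∫ x, f (t, x) ∂(m' t : Measure I)) l := by
    refine tendstoUniformly_of_eventually_equicontinuous (fun ε hε => ?_) fun t =>
      measureTendsto_of_tendsto (hlim t) (f.curry t)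
    obtain ⟨δ, hδ, h⟩ := IsHolderPath.exists_pos_forall_dist_integral_slice_le C f hε
    exact ⟨δ, hδ, hC.mono fun i hi => h (m i) hi⟩
  filter_upwards [Metric.tendstoUniformly_iff.1 hunif (ε / 2) (half_pos hε), hm, hC]
    with i hclose hi hCi
  rw [hi.2 f, dist_comm, dist_eq_norm, ← integral_sub
    (integrable_of_continuous (hm'.continuous_integral_slice f))
    (integrable_of_continuous (hCi.continuous_integral_slice f))]
  refine (norm_integral_le_of_norm_le_const (Eventually.of_forall fun t =>
    (dist_eq_norm _ _).symm.trans_le (hclose t).le)).trans_lt ?_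
  simpa using half_lt_self hε

theorem IsDisintegration.isHolderPath {L : C(Square, ℝ) →ₗ[ℝ] ℝ} {μ ν : Measure Square}
    [IsFiniteMeasure μ] [IsFiniteMeasure ν] {m : I → FiniteMeasure I} (hm : IsDisintegration μ m)
    (hd : IsDominated L μ ν) (hL : IsTimeDerivForm μ L) {C : ℝ} (hμ : μ.real univ ≤ C)
    (hν : ν.real univ ≤ C) : IsHolderPath (4 * C) m := by
  have hC : 0 ≤ C := measureReal_nonneg.trans hμ
  refine ⟨fun t => (hm.real_univ_le hd hL t).trans (by linarith), fun h s t => ?_⟩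
  have hsq : ∫ z, h z.2 ^ 2 ∂ν ≤ ‖h‖ ^ 2 * C := by
    refine (Real.le_norm_self _).trans ((norm_integral_le_of_norm_le_const (C := ‖h‖ ^ 2)
      (Eventually.of_forall fun z => ?_)).trans (by gcongr))
    rw [norm_pow]
    gcongr
    exact h.norm_coe_le_norm _
  refine abs_le_of_sq_le_sq ((hm.sq_integral_sub_le_mul_dist hd hL h s t).trans ?_) (by positivity)
  calc 4 * (2 * μ.real univ + ν.real univ) * (∫ z, h z.2 ^ 2 ∂ν) * dist s t
      ≤ 4 * (2 * C + C) * (‖h‖ ^ 2 * C) * dist s t := by gcongr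
    _ ≤ 16 * C ^ 2 * ‖h‖ ^ 2 * dist s t := by
      linarith [show 0 ≤ C ^ 2 * ‖h‖ ^ 2 * dist s t by positivity]
    _ = (4 * C * ‖h‖ * √(dist s t)) ^ 2 := by rw [mul_pow, Real.sq_sqrt dist_nonneg]; ring

theorem exists_isDisintegration_tendsto {ι : Type*} {U : Ultrafilter ι} {μ ν : ι → Measure Square}
    {μ' ν' : Measure Square} [∀ i, IsFiniteMeasure (μ i)] [∀ i, IsFiniteMeasure (ν i)]
    (hμ : MeasureTendsto μ U μ') (hν : MeasureTendsto ν U ν')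
    (hdom : ∀ᶠ i in (U : Filter ι), ∃ L, IsDominated L (μ i) (ν i) ∧ IsTimeDerivForm (μ i) L)
    {m : ι → I → FiniteMeasure I} (hm : ∀ᶠ i in (U : Filter ι), IsDisintegration (μ i) (m i)) :
    ∃ m' : I → FiniteMeasure I, IsDisintegration μ' m' ∧
      ∀ t, Tendsto (fun i => m i t) U (𝓝 (m' t)) := by
  have hholder : ∀ᶠ i in (U : Filter ι),
      IsHolderPath (4 * (max (μ'.real univ) (ν'.real univ) + 1)) (m i) := by
    filter_upwards [hdom, hm,
      hμ.real_univ.eventually_le_const ((le_max_left _ _).trans_lt (lt_add_one _)),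
      hν.real_univ.eventually_le_const ((le_max_right _ _).trans_lt (lt_add_one _))]
      with i ⟨L, hd, hL⟩ hmi hμi hνi using hmi.isHolderPath hd hL hμi hνi
  obtain ⟨m', -, hm'⟩ := IsHolderPath.exists_tendsto hholder
  exact ⟨m', isDisintegration_of_tendsto hμ hm hholder hm', hm'⟩

/-! ### Stability of the equation `q̇ = η(q) p` -/

/-- The primitive in space `x ↦ ∫₀ˣ r` of a square integrable function. -/
def spacePrim : L2Space →L[ℝ] C(I, ℝ) :=
  LinearMap.mkContinuous
    { toFun r := ⟨fun x => inner ℝ (ind x) r, continuous_ind.inner continuous_const⟩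
      map_add' r r' := by ext; simp [inner_add_right]
      map_smul' c r := by ext; simp [inner_smul_right] }
    1 fun r => (ContinuousMap.norm_le _ (by positivity)).2 fun x =>
      (norm_inner_le_norm _ _).trans
        (mul_le_mul_of_nonneg_right (norm_ind_le x) (norm_nonneg r))

theorem spacePrim_apply (r : L2Space) (x : I) : spacePrim r x = inner ℝ (ind x) r := rfl

theorem norm_spacePrim_le (r : L2Space) : ‖spacePrim r‖ ≤ ‖r‖ :=
  (spacePrim.le_of_opNorm_le (LinearMap.mkContinuous_norm_le _ zero_le_one _) r).trans_eq
    (one_mul _)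

theorem spacePrim_apply_le (r : L2Space) (x : I) : spacePrim r x ≤ ‖r‖ :=
  (le_abs_self _).trans (((spacePrim r).norm_coe_le_norm x).trans (norm_spacePrim_le r))

theorem exists_pos_forall_norm_ind_sub_mul_le (A : ℝ) {ε : ℝ} (hε : 0 < ε) :
    ∃ δ > 0, ∀ s t : I, dist s t < δ → ‖ind t - ind s‖ * A ≤ ε := by
  have hlim := (tendsto_uniformity_iff_dist_tendsto_zero.1
    (CompactSpace.uniformContinuous_of_continuous continuous_ind)).mul_const A
  rw [zero_mul] at hlim
  obtain ⟨δ, hδ, h⟩ := Metric.mem_uniformity_dist.1 (hlim.eventually_le_const hε)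
  exact ⟨δ, hδ, fun s t hst => by simpa only [dist_eq_norm', mem_ofPred_eq] using h hst⟩

theorem TendstoWeakly.tendsto_spacePrim {ι : Type*} {l : Filter ι} [l.NeBot] {r : ι → L2Space}
    {r' : L2Space} {C : ℝ} (hr : TendstoWeakly r l r') (hC : ∀ᶠ i in l, ‖r i‖ ≤ C) :
    Tendsto (fun i => spacePrim (r i)) l (𝓝 (spacePrim r')) := by
  refine ContinuousMap.tendsto_iff_tendstoUniformly.2
    (tendstoUniformly_of_eventually_equicontinuous (fun ε hε => ?_) fun x => hr (ind x))
  obtain ⟨δ, hδ, hind⟩ := exists_pos_forall_norm_ind_sub_mul_le C hε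
  refine ⟨δ, hδ, hC.mono fun i hi x y hxy => ?_⟩
  calc dist (spacePrim (r i) x) (spacePrim (r i) y)
      = ‖inner ℝ (ind y - ind x) (r i)‖ := by
        rw [dist_eq_norm', spacePrim_apply, spacePrim_apply, inner_sub_left]
    _ ≤ ‖ind y - ind x‖ * C := (norm_inner_le_norm _ _).trans (by gcongr)
    _ ≤ ε := hind x y hxy

/-- The exponential of a continuous function. -/
def expMap {X : Type*} [TopologicalSpace X] (f : C(X, ℝ)) : C(X, ℝ) :=
  (⟨Real.exp, Real.continuous_exp⟩ : C(ℝ, ℝ)).comp f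

theorem continuous_expMap {X : Type*} [TopologicalSpace X] :
    Continuous (expMap : C(X, ℝ) → C(X, ℝ)) := ContinuousMap.continuous_postcomp _

/-- The continuous function `(t, x) ↦ η(R(t))(x)` associated with a path `R` in `L²`. -/
def etaPath (R : C(I, L2Space)) : C(Square, ℝ) :=
  expMap ((spacePrim : C(L2Space, C(I, ℝ))).comp R).uncurry

theorem etaPath_apply (R : C(I, L2Space)) (z : Square) :
    etaPath R z = Real.exp (spacePrim (R z.1) z.2) := rfl

theorem norm_partialInner_le_of_ae_le {α β : Type*} [MeasureSpace α] [MeasureSpace β]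
    [SFinite (volume : Measure α)] [SFinite (volume : Measure β)]
    {k : Lp ℝ 2 (volume : Measure α)} {u w : Lp ℝ 2 (volume : Measure (α × β))}
    {A : ℝ} (hA : 0 ≤ A) (h : ∀ᵐ z : α × β, |u z * k z.1| ≤ A * |w z * k z.1|) :
    ‖partialInner k u‖ ≤ ‖k‖ * (A * ‖w‖) := by
  set g := partialInner k u
  have hbound : ∀ᵐ z, ‖u z * tensor k g z‖ ≤ A * (|w| z * |tensor k g| z) := by
    filter_upwards [h, coeFn_tensor k g, Lp.coeFn_abs w, Lp.coeFn_abs (tensor k g)]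
      with z hz htensor hw habs
    rw [hw, habs, htensor, ← mul_assoc, norm_mul, ← abs_mul, ← mul_assoc, abs_mul _ (g z.2),
      ← mul_assoc, ← Real.norm_eq_abs (g z.2)]
    gcongr
    exact hz
  have hsq : ‖g‖ * ‖g‖ ≤ ‖k‖ * (A * ‖w‖) * ‖g‖ :=
    calc ‖g‖ * ‖g‖ = ∫ z, u z * tensor k g z := by
          rw [← real_inner_self_eq_norm_mul_norm, inner_partialInner, real_inner_eq_integral_mul]
      _ ≤ ∫ z, A * (|w| z * |tensor k g| z) :=
          (le_abs_self _).trans (norm_integral_le_of_norm_le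
            ((integrable_coeFn_mul _ _).const_mul A) hbound)
      _ = A * inner ℝ |w| |tensor k g| := by
          rw [integral_const_mul, real_inner_eq_integral_mul]
      _ ≤ A * (‖|w|‖ * ‖|tensor k g|‖) := by gcongr; exact real_inner_le_norm _ _
      _ = ‖k‖ * (A * ‖w‖) * ‖g‖ := by
          rw [norm_abs_eq_norm, norm_abs_eq_norm, norm_tensor]; ring
  rcases (norm_nonneg g).eq_or_lt' with hg | hg
  · rw [hg]; positivity
  · exact le_of_mul_le_mul_right hsq hg

theorem coeFn_ind_sub {s t : I} (hst : s ≤ t) :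
    (ind t - ind s : L2Space) =ᵐ[volume] (Ioc s t).indicator fun _ => (1 : ℝ) := by
  filter_upwards [Lp.coeFn_sub (ind t) (ind s), coeFn_ind t, coeFn_ind s] with x hsub ht hs
  rw [hsub, Pi.sub_apply, ht, hs]
  by_cases h : x ≤ s
  · simp [indicator, h, h.trans hst, not_lt.2 h]
  · simp [indicator, h, not_le.1 h]

/-- The equation `Ṙ = η(R) p`, integrated in time. -/
def IsFlow (p : L2Square) (R : C(I, L2Space)) : Prop :=
  ∀ s t, R t - R s = partialInner (ind t - ind s) (mulLp (etaPath R) p)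

namespace IsFlow

variable {p : L2Square} {R : C(I, L2Space)}

theorem norm_sub_le (h : IsFlow p R) {s t : I} (hst : s ≤ t) {B : ℝ}
    (hB : ∀ τ ∈ Ico s t, ∀ x, spacePrim (R τ) x ≤ B) :
    ‖R t - R s‖ ≤ ‖ind t - ind s‖ * (Real.exp B * ‖p‖) := by
  rw [h s t]
  refine norm_partialInner_le_of_ae_le (Real.exp_nonneg B) ?_
  have hne : ∀ᵐ τ : I, τ ≠ t := compl_mem_ae_iff.2 (measure_singleton t)
  filter_upwards [coeFn_mulLp (etaPath R) p, ae_fst (coeFn_ind_sub hst), ae_fst hne]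
    with z hmul hind hzt
  by_cases hz : z.1 ∈ Ioc s t
  · rw [hmul, etaPath_apply, mul_assoc, abs_mul, Real.abs_exp]
    gcongr
    exact hB _ ⟨hz.1.le, lt_of_le_of_ne hz.2 hzt⟩ _
  · rw [hind, indicator_of_notMem hz]
    simp

theorem norm_sub_le_of_norm_le (h : IsFlow p R) {C : ℝ} (hC : ∀ t, ‖R t‖ ≤ C) (s t : I) :
    ‖R t - R s‖ ≤ ‖ind t - ind s‖ * (Real.exp C * ‖p‖) := by
  wlog hst : s ≤ t generalizing s t
  · rw [norm_sub_rev, norm_sub_rev (ind t)]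
    exact this t s (le_of_not_ge hst)
  · exact h.norm_sub_le hst fun τ _ x => (spacePrim_apply_le _ x).trans (hC τ)

/-- At the first time `t₀` when `R` leaves the open unit ball about `R T`, the bound
`spacePrim (R τ) ≤ B + 1` still holds on `[T, t₀)`. -/
theorem norm_sub_le_one (h : IsFlow p R) {T : I} {B δ : ℝ} (hB : ∀ x, spacePrim (R T) x ≤ B)
    (hδ : √δ * (Real.exp (B + 1) * ‖p‖) < 1) {t : I} (hTt : T ≤ t) (ht : (t : ℝ) ≤ T + δ) :
    ‖R t - R T‖ ≤ 1 := by
  by_contra! hexit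
  have hclosed : IsClosed {τ | T ≤ τ ∧ 1 ≤ ‖R τ - R T‖} :=
    isClosed_Ici.inter (isClosed_le continuous_const (R.continuous.sub continuous_const).norm)
  obtain ⟨t₀, ⟨hT, hexit₀⟩, hmin⟩ := hclosed.isCompact.exists_isLeast ⟨t, hTt, hexit.le⟩
  have hbound (τ) (hτ : τ ∈ Ico T t₀) (x : I) : spacePrim (R τ) x ≤ B + 1 := by
    have hlt : ‖R τ - R T‖ < 1 := by
      by_contra! hge
      exact (hmin ⟨hτ.1, hge⟩).not_gt hτ.2
    have hsub := spacePrim_apply_le (R τ - R T) x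
    rw [map_sub, ContinuousMap.sub_apply] at hsub
    linarith [hB x]
  have ht₀ : (t₀ : ℝ) ≤ t := hmin ⟨hTt, hexit.le⟩
  have hTt₀ : (T : ℝ) ≤ t₀ := hT
  refine hexit₀.not_gt ?_
  calc ‖R t₀ - R T‖ ≤ ‖ind t₀ - ind T‖ * (Real.exp (B + 1) * ‖p‖) := h.norm_sub_le hT hbound
    _ ≤ √δ * (Real.exp (B + 1) * ‖p‖) := by
      rw [norm_ind_sub, abs_of_nonneg (by linarith)]
      gcongr
      linarith
    _ < 1 := hδ

end IsFlow

section FlowLimits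

variable {ι : Type*} {l : Filter ι} [l.NeBot] {p : ι → L2Square} {R : ι → C(I, L2Space)}
  {R' : C(I, L2Space)} {C K : ℝ}

theorem eventually_norm_flow_le_add_one (hflow : ∀ᶠ i in l, IsFlow (p i) (R i))
    (hK : ∀ᶠ i in l, ‖p i‖ ≤ K) {T : I} (hR : TendstoWeakly (fun i => R i T) l (R' T))
    (hC : ∀ᶠ i in l, ‖R i T‖ ≤ C) {δ : ℝ} (hδ : √δ * (Real.exp (‖R'‖ + 1 + 1) * K) < 1) :
    ∀ᶠ i in l, ∀ t, T ≤ t → (t : ℝ) ≤ T + δ → ‖R i t‖ ≤ C + 1 := by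
  have hdist := (hR.tendsto_spacePrim hC).eventually (Metric.ball_mem_nhds _ one_pos)
  filter_upwards [hC, hflow, hK, hdist] with i hC hflow hK hdist t hTt ht
  have hB (x : I) : spacePrim (R i T) x ≤ ‖R'‖ + 1 := by
    have hx := (abs_le.1 ((ContinuousMap.dist_apply_le_dist x).trans hdist.le)).2
    linarith [spacePrim_apply_le (R' T) x, R'.norm_coe_le_norm T]
  have hle := hflow.norm_sub_le_one hB (hδ.trans_le' (by gcongr)) hTt ht
  calc ‖R i t‖ ≤ ‖R i T‖ + ‖R i t - R i T‖ := norm_le_norm_add_norm_sub' _ _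
    _ ≤ C + 1 := add_le_add hC hle

/-- A weakly convergent net need not be bounded. Here, the weak limit bounds `R i` uniformly in
space at one time, and the equation propagates this bound by a fixed time step. -/
theorem exists_eventually_norm_flow_le (hflow : ∀ᶠ i in l, IsFlow (p i) (R i))
    (hK : ∀ᶠ i in l, ‖p i‖ ≤ K) (hR : ∀ t, TendstoWeakly (fun i => R i t) l (R' t))
    (hC : ∀ᶠ i in l, ‖R i 0‖ ≤ C) : ∃ C', ∀ᶠ i in l, ∀ t, ‖R i t‖ ≤ C' := by
  have hlim : Tendsto (fun δ => √δ * (Real.exp (‖R'‖ + 1 + 1) * K)) (𝓝[>] 0) (𝓝 0) := by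
    simpa using ((Real.continuous_sqrt.tendsto 0).mono_left nhdsWithin_le_nhds).mul_const
      (Real.exp (‖R'‖ + 1 + 1) * K)
  obtain ⟨δ, hstep, hδ⟩ := ((hlim.eventually_lt_const one_pos).and self_mem_nhdsWithin).exists
  have hsteps (k : ℕ) : ∃ C', ∀ᶠ i in l, ∀ t : I, (t : ℝ) ≤ k * δ → ‖R i t‖ ≤ C' := by
    induction k with
    | zero =>
      refine ⟨C, hC.mono fun i hi t ht => ?_⟩
      rwa [show t = 0 from Subtype.ext (le_antisymm (by simpa using ht) t.2.1)]
    | succ k ih =>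
      obtain ⟨C', hC'⟩ := ih
      let T : I := projIcc 0 1 zero_le_one (k * δ)
      have hT : (T : ℝ) = min 1 (k * δ) := by
        rw [coe_projIcc, max_eq_right (by positivity)]
      have hnext := eventually_norm_flow_le_add_one hflow hK (hR T)
        (hC'.mono fun i hi => hi T (hT.trans_le (min_le_right _ _))) hstep
      refine ⟨C' + 1, ?_⟩
      filter_upwards [hC', hnext] with i hC' hnext t ht
      rcases le_total (t : ℝ) (k * δ) with htk | htk
      · exact (hC' t htk).trans (le_add_of_nonneg_right zero_le_one)
      · rw [min_eq_right (htk.trans t.2.2)] at hT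
        refine hnext t (hT.trans_le htk) (ht.trans_eq ?_)
        rw [hT]; push_cast; ring
  obtain ⟨k, hk⟩ := exists_nat_ge (1 / δ)
  obtain ⟨C', hC'⟩ := hsteps k
  exact ⟨C', hC'.mono fun i hi t => hi t (t.2.2.trans ((div_le_iff₀ hδ).1 hk))⟩

theorem tendsto_etaPath (hflow : ∀ᶠ i in l, IsFlow (p i) (R i)) (hK : ∀ᶠ i in l, ‖p i‖ ≤ K)
    (hR : ∀ t, TendstoWeakly (fun i => R i t) l (R' t)) (hC : ∀ᶠ i in l, ‖R i 0‖ ≤ C) :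
    Tendsto (fun i => etaPath (R i)) l (𝓝 (etaPath R')) := by
  obtain ⟨C', hC'⟩ := exists_eventually_norm_flow_le hflow hK hR hC
  refine ((continuous_expMap.comp ContinuousMap.continuous_uncurry).tendsto _).comp
    (ContinuousMap.tendsto_iff_tendstoUniformly
      (f := (spacePrim : C(L2Space, C(I, ℝ))).comp R').2
      (tendstoUniformly_of_eventually_equicontinuous (fun ε hε => ?_) fun t =>
        (hR t).tendsto_spacePrim (hC'.mono fun i hi => hi t)))
  obtain ⟨δ, hδ, hind⟩ := exists_pos_forall_norm_ind_sub_mul_le (Real.exp C' * K) hε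
  refine ⟨δ, hδ, ?_⟩
  filter_upwards [hflow, hK, hC'] with i hflow hK hC' s t hst
  calc dist (spacePrim (R i s)) (spacePrim (R i t))
      ≤ ‖R i t - R i s‖ := by
        rw [dist_eq_norm', ← map_sub]
        exact norm_spacePrim_le _
    _ ≤ ‖ind t - ind s‖ * (Real.exp C' * K) :=
        (hflow.norm_sub_le_of_norm_le hC' s t).trans (by gcongr)
    _ ≤ ε := hind s t hst

end FlowLimits

/-! ### Limits of curves -/

theorem inner_toL2 (f : C(I, ℝ)) (p : L2Space) : inner ℝ (toL2 f) p = ∫ x, f x * p x := by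
  rw [real_inner_eq_integral_mul]
  refine integral_congr_ae ?_
  filter_upwards [coeFn_toL2 f] with x hx
  rw [hx]

theorem inner_ind_one (r : L2Space) : inner ℝ (ind 1) r = ∫ x, r x := by
  have Iic_one : Iic (1 : I) = univ := eq_univ_of_forall fun s => s.2.2
  rw [inner_ind, Iic_one, Measure.restrict_univ]

/-- The function `η(r)` as a continuous function. -/
def etaMap (r : L2Space) : C(I, ℝ) := expMap (spacePrim r)

/-- The function `φ(r)` as a continuous function. -/
def phiMap (r : L2Space) : C(I, ℝ) := spacePrim (toL2 (etaMap r))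

theorem eta_eq_etaMap (r : L2Space) (x : I) : eta r x = etaMap r x :=
  congrArg Real.exp (inner_ind x r).symm

theorem phi_eq_phiMap (r : L2Space) (x : I) : phi r x = phiMap r x := by
  rw [phiMap, spacePrim_apply, inner_ind, phi]
  refine integral_congr_ae (ae_restrict_of_ae ?_)
  filter_upwards [coeFn_toL2 (etaMap r)] with y hy
  rw [hy, eta_eq_etaMap]

theorem mem_Q_iff {r : L2Space} : r ∈ Q ↔ inner ℝ (ind 1) r = 0 ∧ ∫ x, etaMap r x = 1 := by
  simp only [Q, mem_ofPred_eq, inner_ind_one, eta_eq_etaMap]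

theorem mem_cotangent_iff {r p : L2Space} : p ∈ cotangent r ↔
    inner ℝ (toL2 (etaMap r)) p = 0 ∧ inner ℝ (toL2 (etaMap r * phiMap r)) p = 0 := by
  simp only [cotangent, mem_ofPred_eq, inner_toL2, eta_eq_etaMap, phi_eq_phiMap,
    ContinuousMap.mul_apply, mul_assoc]

theorem IsContinuousRep.ae_eta_eq {u : L2Square} {R : C(I, L2Space)} (h : IsContinuousRep u R) :
    ∀ᵐ z : Square, eta (fun x => u (z.1, x)) z.2 = etaPath R z := by
  filter_upwards [ae_fst h.2] with z hz
  rw [etaPath_apply, spacePrim_apply, inner_ind, eta, integral_congr_ae (ae_restrict_of_ae hz)]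

/-- The time-continuous representative of an element of `H¹`. -/
def H1.rep (p : H1) : C(I, L2Space) :=
  ⟨fun t => evalAt t (H1.fn p) (H1.dot p), continuous_evalAt _ _⟩

/-- The time-continuous representative of an element of `H²`. -/
def H2.rep (q : H2) : C(I, L2Space) :=
  ⟨fun t => evalAt t (H2.fn q) (H2.dot q), continuous_evalAt _ _⟩

theorem H1.isContinuousRep (p : H1) : IsContinuousRep (H1.fn p) (H1.rep p) :=
  isContinuousRep_evalAt p.2

theorem H2.isContinuousRep (q : H2) : IsContinuousRep (H2.fn q) (H2.rep q) :=
  isContinuousRep_evalAt q.2.1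

theorem ode_iff_dot_eq_mulLp {p : H1} {q : H2} :
    (∀ᵐ z, H2.dot q z = eta (fun u => H2.fn q (z.1, u)) z.2 * H1.fn p z) ↔
      H2.dot q = mulLp (etaPath (H2.rep q)) (H1.fn p) := by
  rw [Lp.ext_iff]
  refine eventually_congr ?_
  filter_upwards [(H2.isContinuousRep q).ae_eta_eq, coeFn_mulLp (etaPath (H2.rep q)) (H1.fn p)]
    with z heta hmul
  rw [heta, hmul]

namespace IsCurve

variable {p : H1} {q : H2} {P R : I → L2Space}

theorem eq_rep (h : IsCurve p q P R) : P = H1.rep p ∧ R = H2.rep q :=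
  ⟨h.rep_p.unique (H1.isContinuousRep p), h.rep_q.unique (H2.isContinuousRep q)⟩

theorem dot_eq_mulLp (h : IsCurve p q P R) :
    H2.dot q = mulLp (etaPath (H2.rep q)) (H1.fn p) :=
  ode_iff_dot_eq_mulLp.1 h.ode

theorem isFlow (h : IsCurve p q P R) : IsFlow (H1.fn p) (H2.rep q) := fun s t => by
  rw [← h.dot_eq_mulLp]
  exact evalAt_sub s t _ _

end IsCurve

section CurveLimits

variable {ι : Type*} {l : Filter ι}

theorem TendstoWeakly.evalAt {u v : ι → L2Square} {u' v' : L2Square} (hu : TendstoWeakly u l u')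
    (hv : TendstoWeakly v l v') (t : I) :
    TendstoWeakly (fun i => evalAt t (u i) (v i)) l (evalAt t u' v') :=
  ((hu.map _).add (hv.map _)).add (hv.map _)

variable [l.NeBot]

theorem TendstoWeakly.eq_of_eventually_eq {H : Type*} [NormedAddCommGroup H]
    [InnerProductSpace ℝ H] {u : ι → H} {u' a : H} (hu : TendstoWeakly u l u')
    (ha : ∀ᶠ i in l, u i = a) : u' = a :=
  ext_inner_left ℝ fun h => tendsto_nhds_unique_of_eventuallyEq (hu h) tendsto_const_nhds
    (ha.mono fun _ hi => congrArg (inner ℝ h) hi)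

theorem TendstoWeakly.eq_mulLp {X : Type*} [TopologicalSpace X] [CompactSpace X]
    [MeasureSpace X] [BorelSpace X] [IsFiniteMeasure (volume : Measure X)]
    {u v : ι → Lp ℝ 2 (volume : Measure X)} {u' v' : Lp ℝ 2 (volume : Measure X)}
    {f : ι → C(X, ℝ)} {f' : C(X, ℝ)} {K : ℝ} (hv : TendstoWeakly v l v')
    (hf : Tendsto f l (𝓝 f')) (hu : TendstoWeakly u l u') (hK : ∀ᶠ i in l, ‖u i‖ ≤ K)
    (h : ∀ᶠ i in l, v i = mulLp (f i) (u i)) : v' = mulLp f' u' := by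
  refine ext_inner_left ℝ fun g => ?_
  have hlim : Tendsto (fun i => mulLp (f i) g) l (𝓝 (mulLp f' g)) :=
    ((mulLp.continuous.clm_apply continuous_const).tendsto f').comp hf
  have mulLp_symm (f : C(X, ℝ)) (u : Lp ℝ 2 (volume : Measure X)) :
      inner ℝ g (mulLp f u) = inner ℝ (mulLp f g) u := by
    rw [real_inner_comm, inner_mulLp_comm]
  rw [mulLp_symm]
  refine tendsto_nhds_unique_of_eventuallyEq (hv g) (hu.inner_of_tendsto hK hlim)
    (h.mono fun i hi => (congrArg (inner ℝ g) hi).trans (mulLp_symm _ _))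

theorem mem_Q_of_tendsto {r : ι → L2Space} {r' : L2Space} (hr : TendstoWeakly r l r')
    (heta : Tendsto (fun i => etaMap (r i)) l (𝓝 (etaMap r'))) (h : ∀ᶠ i in l, r i ∈ Q) :
    r' ∈ Q := by
  have hint := ((continuous_integral_continuousMap volume).tendsto _).comp heta
  exact mem_Q_iff.2
    ⟨tendsto_nhds_unique_of_eventuallyEq (hr (ind 1)) tendsto_const_nhds
      (h.mono fun i hi => (mem_Q_iff.1 hi).1),
    tendsto_nhds_unique_of_eventuallyEq hint tendsto_const_nhds
      (h.mono fun i hi => (mem_Q_iff.1 hi).2)⟩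

theorem mem_cotangent_of_tendsto {r p : ι → L2Space} {r' p' : L2Space} {K : ℝ}
    (heta : Tendsto (fun i => etaMap (r i)) l (𝓝 (etaMap r'))) (hp : TendstoWeakly p l p')
    (hK : ∀ᶠ i in l, ‖p i‖ ≤ K) (h : ∀ᶠ i in l, p i ∈ cotangent (r i)) : p' ∈ cotangent r' := by
  have hphi : Tendsto (fun i => phiMap (r i)) l (𝓝 (phiMap r')) :=
    ((spacePrim.comp toL2).continuous.tendsto _).comp heta
  have inner_lim {f : ι → C(I, ℝ)} {f' : C(I, ℝ)} (hf : Tendsto f l (𝓝 f')) :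
      Tendsto (fun i => inner ℝ (toL2 (f i)) (p i)) l (𝓝 (inner ℝ (toL2 f') p')) :=
    hp.inner_of_tendsto hK ((toL2.continuous.tendsto _).comp hf)
  exact mem_cotangent_iff.2
    ⟨tendsto_nhds_unique_of_eventuallyEq (inner_lim heta) tendsto_const_nhds
      (h.mono fun i hi => (mem_cotangent_iff.1 hi).1),
    tendsto_nhds_unique_of_eventuallyEq (inner_lim (heta.mul hphi)) tendsto_const_nhds
      (h.mono fun i hi => (mem_cotangent_iff.1 hi).2)⟩

theorem isCurve_of_tendsto {p : ι → H1} {q : ι → H2} {p' : H1} {q' : H2} {K C : ℝ}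
    (hp : TendstoWeakly (fun i => H1.fn (p i)) l (H1.fn p'))
    (hpdot : TendstoWeakly (fun i => H1.dot (p i)) l (H1.dot p'))
    (hq : TendstoWeakly (fun i => H2.fn (q i)) l (H2.fn q'))
    (hqdot : TendstoWeakly (fun i => H2.dot (q i)) l (H2.dot q'))
    (hK : ∀ᶠ i in l, ‖H1.fn (p i)‖ ≤ K) (hKdot : ∀ᶠ i in l, ‖H1.dot (p i)‖ ≤ K)
    (hC : ∀ᶠ i in l, ‖H2.rep (q i) 0‖ ≤ C)
    (h : ∀ᶠ i in l, IsCurve (p i) (q i) (H1.rep (p i)) (H2.rep (q i))) :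
    IsCurve p' q' (H1.rep p') (H2.rep q') := by
  have hR (t : I) : TendstoWeakly (fun i => H2.rep (q i) t) l (H2.rep q' t) := hq.evalAt hqdot t
  have hP (t : I) : TendstoWeakly (fun i => H1.rep (p i) t) l (H1.rep p' t) := hp.evalAt hpdot t
  have norm_rep_le (t : I) : ∀ᶠ i in l, ‖H1.rep (p i) t‖ ≤ K + 2 * K := by
    filter_upwards [hK, hKdot] with i hi hi'
    exact (norm_evalAt_le t _ _).trans (by gcongr)
  have hetaPath := tendsto_etaPath (h.mono fun i hi => hi.isFlow) hK hR hC
  have heta (t : I) : Tendsto (fun i => etaMap (H2.rep (q i) t)) l (𝓝 (etaMap (H2.rep q' t))) :=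
    (((continuous_eval_const t).comp ContinuousMap.continuous_curry).tendsto _).comp hetaPath
  exact
    { rep_p := H1.isContinuousRep p'
      rep_q := H2.isContinuousRep q'
      mem_Q t := mem_Q_of_tendsto (hR t) (heta t) (h.mono fun i hi => hi.mem_Q t)
      mem_cotangent t := mem_cotangent_of_tendsto (heta t) (hP t) (norm_rep_le t)
        (h.mono fun i hi => hi.mem_cotangent t)
      ode := ode_iff_dot_eq_mulLp.2
        (hqdot.eq_mulLp hetaPath hp hK (h.mono fun i hi => hi.dot_eq_mulLp)) }

end CurveLimits

/-! ### Closedness of the sets of relaxed curves -/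

theorem norm_sq_le_of_sqMeasure_le {α : Type*} [MeasureSpace α]
    {u : Lp ℝ 2 (volume : Measure α)} {μ : Measure α} [IsFiniteMeasure μ]
    (h : sqMeasure u ≤ μ) : ‖u‖ ^ 2 ≤ μ.real univ := by
  have hmass := integral_sqMeasure (aemeasurable_coeFn u) fun _ => 1
  simp only [integral_const, smul_eq_mul, mul_one] at hmass
  rw [norm_sq_eq_integral_sq, ← hmass]
  exact ENNReal.toReal_mono (measure_ne_top _ _) (h univ)

theorem eventually_norm_le_of_sqMeasure_le {ι X : Type*} {l : Filter ι}
    [TopologicalSpace X] [MeasureSpace X] {u : ι → Lp ℝ 2 (volume : Measure X)}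
    {μ : ι → Measure X} {μ' : Measure X} [∀ i, IsFiniteMeasure (μ i)]
    (hμ : MeasureTendsto μ l μ') (h : ∀ᶠ i in l, sqMeasure (u i) ≤ μ i) :
    ∀ᶠ i in l, ‖u i‖ ≤ √(μ'.real univ + 1) := by
  filter_upwards [h, hμ.real_univ.eventually_le_const (lt_add_one _)] with i hle hmass
  exact Real.le_sqrt_of_sq_le ((norm_sq_le_of_sqMeasure_le hle).trans hmass)

theorem tendstoWeakly_of_tendsto_weakSpace {ι E H : Type*} [NormedAddCommGroup E]
    [NormedSpace ℝ E] [NormedAddCommGroup H] [InnerProductSpace ℝ H] {l : Filter ι}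
    {x : ι → WeakSpace ℝ E} {x' : WeakSpace ℝ E} (A : E →L[ℝ] H) (hx : Tendsto x l (𝓝 x')) :
    TendstoWeakly (fun i => A ((toWeakSpace ℝ E).symm (x i))) l
      (A ((toWeakSpace ℝ E).symm x')) := fun h =>
  ((WeakBilin.eval_continuous (topDualPairing ℝ E).flip ((innerSL ℝ h).comp A)).tendsto
    x').comp hx

instance (w : RelaxedSpace) : IsFiniteMeasure w.μ :=
  inferInstanceAs (IsFiniteMeasure (w.2.2.1 : Measure Square))

instance (w : RelaxedSpace) : IsFiniteMeasure w.ν :=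
  inferInstanceAs (IsFiniteMeasure (w.2.2.2 : Measure Square))

namespace RelaxedSpace

variable {l : Filter RelaxedSpace} {w' : RelaxedSpace}

theorem tendstoWeakly_fn_p (hl : l ≤ 𝓝 w') :
    TendstoWeakly (fun w : RelaxedSpace => H1.fn w.p) l (H1.fn w'.p) :=
  tendstoWeakly_of_tendsto_weakSpace
    ((ContinuousLinearMap.fst ℝ L2Square L2Square).comp H1.subtypeL)
    ((continuous_fst.tendsto w').mono_left hl)

theorem tendstoWeakly_dot_p (hl : l ≤ 𝓝 w') :
    TendstoWeakly (fun w : RelaxedSpace => H1.dot w.p) l (H1.dot w'.p) :=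
  tendstoWeakly_of_tendsto_weakSpace
    ((ContinuousLinearMap.snd ℝ L2Square L2Square).comp H1.subtypeL)
    ((continuous_fst.tendsto w').mono_left hl)

theorem tendstoWeakly_fn_q (hl : l ≤ 𝓝 w') :
    TendstoWeakly (fun w : RelaxedSpace => H2.fn w.q) l (H2.fn w'.q) :=
  tendstoWeakly_of_tendsto_weakSpace
    ((ContinuousLinearMap.fst ℝ L2Square (L2Square × L2Square)).comp H2.subtypeL)
    (((continuous_fst.comp continuous_snd).tendsto w').mono_left hl)

theorem tendstoWeakly_dot_q (hl : l ≤ 𝓝 w') :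
    TendstoWeakly (fun w : RelaxedSpace => H2.dot w.q) l (H2.dot w'.q) :=
  tendstoWeakly_of_tendsto_weakSpace
    ((ContinuousLinearMap.fst ℝ L2Square L2Square).comp
      ((ContinuousLinearMap.snd ℝ L2Square (L2Square × L2Square)).comp H2.subtypeL))
    (((continuous_fst.comp continuous_snd).tendsto w').mono_left hl)

theorem measureTendsto_μ (hl : l ≤ 𝓝 w') :
    MeasureTendsto (fun w : RelaxedSpace => w.μ) l w'.μ :=
  measureTendsto_of_tendsto
    (((continuous_fst.comp (continuous_snd.comp continuous_snd)).tendsto w').mono_left hl)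

theorem measureTendsto_ν (hl : l ≤ 𝓝 w') :
    MeasureTendsto (fun w : RelaxedSpace => w.ν) l w'.ν :=
  measureTendsto_of_tendsto
    (((continuous_snd.comp (continuous_snd.comp continuous_snd)).tendsto w').mono_left hl)

end RelaxedSpace

/-- `w` is a relaxed curve, without conditions at the end points, and `μ = m(t) dt`. -/
structure IsRelaxedCurve (w : RelaxedSpace) (m : I → FiniteMeasure I) : Prop where
  isCurve : IsCurve w.p w.q (H1.rep w.p) (H2.rep w.q)
  isRelaxation : IsRelaxation w.p w.μ w.ν
  isDisintegration : IsDisintegration w.μ m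

/-- The condition `p(t) = a`, `q(t) = b`, `μ(t) = a²` imposed on relaxed curves at the end
points. -/
structure HasValueAt (w : RelaxedSpace) (m : I → FiniteMeasure I) (t : I) (a b : L2Space) :
    Prop where
  p_eq : H1.rep w.p t = a
  q_eq : H2.rep w.q t = b
  measure_eq : (m t : Measure I) = sqMeasure a

theorem mem_relaxedCurves0_iff {p₀ q₀ : L2Space} {w : RelaxedSpace} :
    w ∈ relaxedCurves0 p₀ q₀ ↔ ∃ m, IsRelaxedCurve w m ∧ HasValueAt w m 0 p₀ q₀ := by
  constructor
  · rintro ⟨⟨P, R, hcurve, hP, hR⟩, hrel, m, hm, hm₀⟩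
    obtain ⟨rfl, rfl⟩ := hcurve.eq_rep
    exact ⟨m, ⟨hcurve, hrel, hm⟩, ⟨hP, hR, hm₀⟩⟩
  · rintro ⟨m, h, h₀⟩
    exact ⟨⟨_, _, h.isCurve, h₀.p_eq, h₀.q_eq⟩, h.isRelaxation, m, h.isDisintegration,
      h₀.measure_eq⟩

theorem mem_relaxedCurves01_iff {p₀ q₀ p₁ q₁ : L2Space} {w : RelaxedSpace} :
    w ∈ relaxedCurves01 p₀ q₀ p₁ q₁ ↔
      ∃ m, IsRelaxedCurve w m ∧ HasValueAt w m 0 p₀ q₀ ∧ HasValueAt w m 1 p₁ q₁ := by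
  constructor
  · rintro ⟨⟨P, R, hcurve, hP₀, hR₀, hP₁, hR₁⟩, hrel, m, hm, hm₀, hm₁⟩
    obtain ⟨rfl, rfl⟩ := hcurve.eq_rep
    exact ⟨m, ⟨hcurve, hrel, hm⟩, ⟨hP₀, hR₀, hm₀⟩, ⟨hP₁, hR₁, hm₁⟩⟩
  · rintro ⟨m, h, h₀, h₁⟩
    exact ⟨⟨_, _, h.isCurve, h₀.p_eq, h₀.q_eq, h₁.p_eq, h₁.q_eq⟩, h.isRelaxation, m,
      h.isDisintegration, h₀.measure_eq, h₁.measure_eq⟩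

theorem HasValueAt.of_tendsto {l : Filter RelaxedSpace} [l.NeBot] {w' : RelaxedSpace}
    {m : RelaxedSpace → I → FiniteMeasure I} {m' : I → FiniteMeasure I} {t : I} {a b : L2Space}
    (hl : l ≤ 𝓝 w') (hm : Tendsto (fun w => m w t) l (𝓝 (m' t)))
    (h : ∀ᶠ w in l, HasValueAt w (m w) t a b) : HasValueAt w' m' t a b where
  p_eq := ((RelaxedSpace.tendstoWeakly_fn_p hl).evalAt (RelaxedSpace.tendstoWeakly_dot_p hl)
    t).eq_of_eventually_eq (h.mono fun _ hw => hw.p_eq)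
  q_eq := ((RelaxedSpace.tendstoWeakly_fn_q hl).evalAt (RelaxedSpace.tendstoWeakly_dot_q hl)
    t).eq_of_eventually_eq (h.mono fun _ hw => hw.q_eq)
  measure_eq := by
    let sq : FiniteMeasure I := ⟨sqMeasure a, inferInstance⟩
    have heq : ∀ᶠ w in l, m w t = sq := h.mono fun _ hw => Subtype.ext hw.measure_eq
    rw [tendsto_nhds_unique_of_eventuallyEq hm tendsto_const_nhds heq]
    rfl

theorem exists_isRelaxedCurve_tendsto {U : Ultrafilter RelaxedSpace} {w' : RelaxedSpace}
    {m : RelaxedSpace → I → FiniteMeasure I} {C : ℝ} (hU : (U : Filter RelaxedSpace) ≤ 𝓝 w')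
    (h : ∀ᶠ w in (U : Filter RelaxedSpace), IsRelaxedCurve w (m w))
    (hC : ∀ᶠ w in (U : Filter RelaxedSpace), ‖H2.rep w.q 0‖ ≤ C) :
    ∃ m', IsRelaxedCurve w' m' ∧ ∀ t, Tendsto (fun w => m w t) U (𝓝 (m' t)) := by
  have hp := RelaxedSpace.tendstoWeakly_fn_p hU
  have hpdot := RelaxedSpace.tendstoWeakly_dot_p hU
  have hμ := RelaxedSpace.measureTendsto_μ hU
  have hν := RelaxedSpace.measureTendsto_ν hU
  have hK := eventually_norm_le_of_sqMeasure_le hμ (h.mono fun w hw => hw.isRelaxation.sq_le)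
  have hKdot :=
    eventually_norm_le_of_sqMeasure_le hν (h.mono fun w hw => hw.isRelaxation.sq_dot_le)
  obtain ⟨m', hm', hlim⟩ := exists_isDisintegration_tendsto hμ hν
    (h.mono fun w hw => hw.isRelaxation.exists_isDominated)
    (h.mono fun w hw => hw.isDisintegration)
  refine ⟨m', ⟨?_, ?_, hm'⟩, hlim⟩
  · exact isCurve_of_tendsto hp hpdot (RelaxedSpace.tendstoWeakly_fn_q hU)
      (RelaxedSpace.tendstoWeakly_dot_q hU)
      (hK.mono fun w hw => hw.trans (le_max_left _ _))
      (hKdot.mono fun w hw => hw.trans (le_max_right _ _)) hC (h.mono fun w hw => hw.isCurve)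
  · exact isRelaxation_of_tendsto hp hpdot hμ hν (h.mono fun w hw => hw.isRelaxation)

theorem isClosed_relaxedCurves0 (p₀ q₀ : L2Space) : IsClosed (relaxedCurves0 p₀ q₀) := by
  refine isClosed_iff_ultrafilter.2 fun w' U hU hmem => ?_
  obtain ⟨m, hm⟩ :=
    (Eventually.mono hmem fun w hw => mem_relaxedCurves0_iff.1 hw).choice
  obtain ⟨m', hm', hlim⟩ := exists_isRelaxedCurve_tendsto hU (hm.mono fun w hw => hw.1)
    (hm.mono fun w hw => (congrArg norm hw.2.q_eq).le)
  exact mem_relaxedCurves0_iff.2 ⟨m', hm', .of_tendsto hU (hlim 0) (hm.mono fun w hw => hw.2)⟩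

theorem isClosed_relaxedCurves01 (p₀ q₀ p₁ q₁ : L2Space) :
    IsClosed (relaxedCurves01 p₀ q₀ p₁ q₁) := by
  refine isClosed_iff_ultrafilter.2 fun w' U hU hmem => ?_
  obtain ⟨m, hm⟩ :=
    (Eventually.mono hmem fun w hw => mem_relaxedCurves01_iff.1 hw).choice
  obtain ⟨m', hm', hlim⟩ := exists_isRelaxedCurve_tendsto hU (hm.mono fun w hw => hw.1)
    (hm.mono fun w hw => (congrArg norm hw.2.1.q_eq).le)
  exact mem_relaxedCurves01_iff.2 ⟨m', hm',
    .of_tendsto hU (hlim 0) (hm.mono fun w hw => hw.2.1),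
    .of_tendsto hU (hlim 1) (hm.mono fun w hw => hw.2.2)⟩

end RelaxedCubics

end

theorem mainTheorem10 (p₀ q₀ p₁ q₁ : RelaxedCubics.L2Space) :
    IsClosed (RelaxedCubics.relaxedCurves0 p₀ q₀) ∧
      IsClosed (RelaxedCubics.relaxedCurves01 p₀ q₀ p₁ q₁) :=
  ⟨RelaxedCubics.isClosed_relaxedCurves0 p₀ q₀, RelaxedCubics.isClosed_relaxedCurves01 p₀ q₀ p₁ q₁⟩
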